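/- Let $G$ be a finite nilpotent group of class $2$ and let $K$ be a subgroup of $G$ with $G'\le K\le Z(G)$. For an index set $A$ let $G^A$ be the direct power of copies of $G$ consisting of the families $(g_i)_{i\in A}$ with $g_i=1$ for all but finitely many $i$, let $(K^A)^0$ be the subgroup of those families with all entries in $K$ and $\prod_{i\in A} g_i=1$, and put $G(A;K)=G^A/(K^A)^0$ (the central product of copies of $G$ amalgamated over $K$). Write $G(\omega;K)$ and $G(n;K)$ for $A=\omega$ and $A=\{0,\dots,n-1\}$. For $n\ge1$ the group $G(n;K)$ is identified with the subgroup of $G(\omega;K)$ generated by the first $n$ copies of $G$, and $K$ is identified with its common copy in all these groups. Let $L_K$ be the language of groups with an additional constant for every element of $K$. A finite substructure $N$ of a structure $M$ is called here an approximation of $M$ if every $0$-definable relation on $M$ induces a $0$-definable relation on $N$, and any two enumerations $\bar a,\bar b$ of (all of) $N$ have the same type in $N$ if and only if they have the same type in $M$. The structure $M$ is called smoothly approximable if it is $\omega$-categorical and every finite subset of $M$ is contained in an approximation of $M$. An ordering $<$ of type $\omega$ of $M$ is an AZ-enumeration of $M$ if for each $n$ and any sequence $(\bar a_i)_{i\in\omega}$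 of $n$-tuples of $M$ there are $i<j$ and an order preserving elementary map $\alpha:M\to M$ with $\alpha(\bar a_i)=\bar a_j$. Then the following hold. (1) The expansion of $G(\omega;K)$ by constants for all elements of $K$ is smoothly approximable (as an $L_K$-structure). (2) More precisely, for every $n\ge 1$ the natural map $G(n;K)\to G(\omega;K)$ is an embedding of $L_K$-structures whose image is an approximation of $G(\omega;K)$, and every finite subset of $G(\omega;K)$ is contained in one of these images. (3) The group $G(\omega;K)$ (in the language of groups) has an AZ-enumeration. -/

import Mathlib

open FirstOrder

universe u v w

/-! ### The first-order language of groups -/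

/-- Function symbols of the language of groups: multiplication, inversion, identity. -/
inductive GroupFunc : ℕ → Type
  | mul : GroupFunc 2
  | inv : GroupFunc 1
  | one : GroupFunc 0

/-- The first-order language of groups (no relation symbols besides equality). -/
def groupLanguage : FirstOrder.Language.{0, 0} := ⟨GroupFunc, fun _ => Empty⟩

/-- Every group is a structure in the language of groups. -/
instance groupStructure (G : Type u) [Group G] : groupLanguage.Structure G where
  funMap {_} f x := match f with
    | GroupFunc.mul => x 0 * x 1
    | GroupFunc.inv => (x 0)⁻¹
    | GroupFunc.one => 1
  RelMap {_} r _ := r.elim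

/-! ### Central products of copies of a group amalgamated over a central subgroup -/

section CentralProduct

open scoped IsMulCommutative

variable {G : Type u} [Group G]

/-- The direct power of copies of `G` indexed by `A`: families `(g_i)_{i ∈ A}` with `g_i = 1` for
all but finitely many `i`. -/
def restrictedPower (A : Type v) (G : Type u) [Group G] : Subgroup (A → G) where
  carrier := {f | (Function.mulSupport f).Finite}
  one_mem' := by simp
  mul_mem' {f g} hf hg := (hf.union hg).subset (Function.mulSupport_mul f g)
  inv_mem' {f} hf := by simpa using hf

/-- The subgroup of the direct power consisting of the families with all entries in the central
subgroup `K` whose product is `1`. The product is taken in the commutative group `Z(G)`; only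
entries lying in `Z(G)` are admitted, which is no restriction as soon as `K ≤ Z(G)`. -/
def amalgamationKernel (A : Type v) (K : Subgroup G) : Subgroup (restrictedPower A G) where
  carrier := {f | ∃ γ : A → Subgroup.center G,
    (∀ i, (γ i : G) = f.1 i) ∧ (∀ i, f.1 i ∈ K) ∧ ∏ᶠ i, γ i = 1}
  one_mem' := ⟨1, by simp, by simp [K.one_mem], by simp⟩
  mul_mem' := by
    rintro f g ⟨γ, h1, h2, h3⟩ ⟨δ, k1, k2, k3⟩
    have e : ∀ (f : restrictedPower A G) (γ : A → Subgroup.center G),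
        (∀ i, (γ i : G) = f.1 i) → (Function.mulSupport γ).Finite := by
      intro f γ h
      refine f.2.subset fun i hi => ?_
      simp only [Function.mem_mulSupport] at hi ⊢
      rw [← h i]
      simpa using hi
    refine ⟨γ * δ, fun i => by simp [h1, k1], fun i => K.mul_mem (h2 i) (k2 i), ?_⟩
    have := finprod_mul_distrib (e f γ h1) (e g δ k1)
    simpa [h3, k3] using this
  inv_mem' := by
    rintro f ⟨γ, h1, h2, h3⟩
    refine ⟨γ⁻¹, fun i => by simp [h1], fun i => K.inv_mem (h2 i), ?_⟩
    simpa [h3] using finprod_inv_distrib γ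

instance amalgamationKernel_normal (A : Type v) (K : Subgroup G) :
    (amalgamationKernel A K).Normal where
  conj_mem := by
    rintro f ⟨γ, h1, h2, h3⟩ g
    have : g * f * g⁻¹ = f := by
      ext i
      have h := (Subgroup.mem_center_iff.1 (γ i).2) (g.1 i)
      rw [h1 i] at h
      simp [h]
    rw [this]
    exact ⟨γ, h1, h2, h3⟩

/-- The central product `G(A; K)` of copies of `G` indexed by `A`, amalgamated over `K`. -/
abbrev CentralProduct (A : Type v) (K : Subgroup G) : Type (max u v) :=
  restrictedPower A G ⧸ amalgamationKernel A K

open Classical in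
/-- The family with entry `g` at the index `i` and all other entries `1`. -/
noncomputable def singleEntry {A : Type v} (i : A) (g : G) : restrictedPower A G :=
  ⟨Pi.mulSingle i g, (Set.finite_singleton i).subset Pi.mulSupport_mulSingle_subset⟩

/-- The copy in `G(A; K)` of an element `k` of `K`. The index at which `k` is placed is
irrelevant for `K ≤ Z(G)`, see `baseElement_eq`. -/
noncomputable def baseElement (A : Type v) [Nonempty A] (K : Subgroup G) (k : K) :
    CentralProduct A K :=
  QuotientGroup.mk (singleEntry (Classical.arbitrary A) (k : G))

theorem baseElement_eq {A : Type v} [Nonempty A] {K : Subgroup G} (hK : K ≤ Subgroup.center G)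
    (k : K) (i : A) :
    baseElement A K k = QuotientGroup.mk (singleEntry i (k : G)) := by
  classical
  unfold baseElement
  generalize Classical.arbitrary A = j
  rw [QuotientGroup.eq]
  let c : Subgroup.center G := ⟨k, hK k.2⟩
  have hs : ∀ (i : A) (c : Subgroup.center G),
      (Function.mulSupport (Pi.mulSingle i c : A → Subgroup.center G)).Finite := fun i c =>
    (Set.finite_singleton i).subset Pi.mulSupport_mulSingle_subset
  have hp : ∀ (i : A) (c : Subgroup.center G), ∏ᶠ x, (Pi.mulSingle i c : A → _) x = c := by
    intro i c
    rw [finprod_eq_single _ i (fun x hx => by simp [hx])]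
    simp
  have hc : ∀ (i x : A), ((Pi.mulSingle i c : A → Subgroup.center G) x : G)
      = (Pi.mulSingle i (k : G) : A → G) x := by
    intro i x
    by_cases h : x = i
    · subst h; simp [c]
    · simp [h]
  have hKm : ∀ (i x : A), (Pi.mulSingle i (k : G) : A → G) x ∈ K := by
    intro i x
    by_cases h : x = i
    · subst h; simp
    · simp [h, K.one_mem]
  refine ⟨(Pi.mulSingle j c)⁻¹ * Pi.mulSingle i c, fun x => ?_, fun x => ?_, ?_⟩
  · simp [singleEntry, hc]
  · exact K.mul_mem (K.inv_mem (hKm j x)) (hKm i x)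
  · have := finprod_mul_distrib (f := (Pi.mulSingle j c)⁻¹) (g := Pi.mulSingle i c)
      (by rw [Function.HasFiniteMulSupport, Function.mulSupport_inv]; exact hs j c) (hs i c)
    have h2 := finprod_inv_distrib (Pi.mulSingle j c : A → Subgroup.center G)
    simp only [Pi.mul_apply, Pi.inv_apply] at this ⊢
    rw [this, h2, hp, hp]
    simp

/-- The constant symbol of `k : K` is interpreted in `G(A; K)` by the copy of `k`. Together with
`groupStructure` this makes `G(A; K)` a structure for `groupLanguage[[K]]`. -/
noncomputable instance baseConstants (A : Type v) [Nonempty A] (K : Subgroup G) :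
    (Language.constantsOn K).Structure (CentralProduct A K) :=
  Language.constantsOn.structure (baseElement A K)

/-- Extension by `1` of a finite family of length `n` to a family indexed by `ℕ`. -/
noncomputable def extendPower (G : Type u) [Group G] (n : ℕ) :
    restrictedPower (Fin n) G →* restrictedPower ℕ G :=
  ((Function.ExtendByOne.hom G (Fin.val : Fin n → ℕ)).comp
    (restrictedPower (Fin n) G).subtype).codRestrict _ (by
      intro f
      refine ((Set.finite_lt_nat n)).subset fun i hi => ?_
      by_contra h
      refine hi (Function.extend_apply' _ _ _ ?_)
      rintro ⟨a, rfl⟩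
      exact h a.2)

/-- The natural homomorphism `G(n; K) → G(ω; K)` onto the subgroup generated by the first `n`
copies of `G`. -/
noncomputable def levelMap (K : Subgroup G) (n : ℕ) :
    CentralProduct (Fin n) K →* CentralProduct ℕ K :=
  QuotientGroup.map _ _ (extendPower G n) (by
    rintro f ⟨γ, h1, h2, h3⟩
    have hx : ∀ a : Fin n, (extendPower G n f).1 a = f.1 a := fun a =>
      Fin.val_injective.extend_apply _ _ a
    have hx' : ∀ i : ℕ, (¬ ∃ a : Fin n, (a : ℕ) = i) → (extendPower G n f).1 i = 1 := fun i hi =>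
      Function.extend_apply' _ _ _ hi
    refine ⟨Function.extend Fin.val γ 1, fun i => ?_, fun i => ?_, ?_⟩
    · by_cases hi : ∃ a : Fin n, (a : ℕ) = i
      · obtain ⟨a, rfl⟩ := hi
        rw [hx, Fin.val_injective.extend_apply, h1]
      · rw [hx' i hi, Function.extend_apply' _ _ _ hi]
        rfl
    · by_cases hi : ∃ a : Fin n, (a : ℕ) = i
      · obtain ⟨a, rfl⟩ := hi
        rw [hx]; exact h2 a
      · rw [hx' i hi]; exact K.one_mem
    · have hs : Function.mulSupport (Function.extend Fin.val γ (1 : ℕ → Subgroup.center G))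
          ⊆ Set.range (Fin.val : Fin n → ℕ) := by
        intro i hi
        by_contra h
        exact hi (Function.extend_apply' _ _ _ h)
      rw [← finprod_mem_univ, finprod_mem_inter_mulSupport_eq _ _
        (Set.range (Fin.val : Fin n → ℕ)) (by
          rw [Set.univ_inter, Set.inter_eq_right.2 hs]),
        finprod_mem_range Fin.val_injective]
      simpa [Fin.val_injective.extend_apply] using h3)

end CentralProduct

/-! ### Model-theoretic notions -/

section ModelTheory

variable (L : FirstOrder.Language.{u, v}) (M : Type w) [L.Structure M]

/-- `M` is countably infinite and its complete theory has, up to isomorphism, exactly one model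
that is countably infinite. -/
def OmegaCategorical : Prop :=
  Countable M ∧ Infinite M ∧ Cardinal.Categorical (Cardinal.aleph0.{w}) (L.completeTheory M)

variable {L M} in
/-- Two tuples of elements of `M` have the same complete type in `M` (without parameters). -/
def SameType {k : ℕ} (a b : Fin k → M) : Prop :=
  ∀ φ : L.Formula (Fin k), φ.Realize a ↔ φ.Realize b

variable {L M} in
/-- A finite substructure `N` of `M` such that every `0`-definable relation on `M` induces a
`0`-definable relation on `N`, and any two enumerations of `N` have the same type in `N` if and
only if they have the same type in `M`. -/
def IsFiniteApproximation (N : L.Substructure M) : Prop :=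
  Finite N ∧
  (∀ (k : ℕ) (R : Set (Fin k → M)), (∅ : Set M).Definable L R →
    (∅ : Set N).Definable L {x : Fin k → N | (fun i => (x i : M)) ∈ R}) ∧
  (∀ (k : ℕ) (a b : Fin k → N), Function.Surjective a → Function.Surjective b →
    (SameType (L := L) a b ↔
      SameType (L := L) (fun i => (a i : M)) (fun i => (b i : M))))

/-- `M` is `ω`-categorical and every finite subset is contained in a finite approximation. -/
def SmoothlyApproximable : Prop :=
  OmegaCategorical L M ∧
  ∀ F : Set M, F.Finite → ∃ N : L.Substructure M, F ⊆ N ∧ IsFiniteApproximation N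

variable {M} in
/-- An ordering of `M` of type `ω`, given by its enumeration `e : ℕ ≃ M` (so that `x < y` means
`e.symm x < e.symm y`), is an AZ-enumeration: every infinite sequence of `n`-tuples has two
members, the earlier of which is carried to the later by an order preserving elementary map
`M → M`. -/
def IsAZEnumeration (e : ℕ ≃ M) : Prop :=
  ∀ (n : ℕ) (a : ℕ → Fin n → M), ∃ i j : ℕ, i < j ∧ ∃ α : M ↪ₑ[L] M,
    (∀ x y : M, e.symm x < e.symm y → e.symm (α x) < e.symm (α y)) ∧
    ∀ t : Fin n, α (a i t) = a j t

end ModelTheory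

/-! Because `G' ≤ K ≤ Z(G)`, symmetries of `G(ω; K)` come from integer linear algebra modulo `2|G|`.
A finitely supported integer vector `v` gives the map `theta K v` sending `x` to the class of `(x ^
v i)`. By `(xy)^n = x^n y^n c^(n(n-1)/2)` with `c` in `K`, this is a homomorphism over `K` when `v ·
v` and the sum of the entries are both congruent to `1`, and the images for `v` and `w` commute when
`v · w` is congruent to `0`. Hence an orthonormal sequence defines an endomorphism over `K`, and a
reflection in a vector of norm `2` and entry sum `0` defines an automorphism. Products of such
reflections carry an orthonormal system to any other of the same size orthogonal to it
(`exists_equiv_theta`).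

Approximation: by the universal property, an automorphism of `G(n; K)` over `K` extends by the
identity on the remaining copies, and a finite substructure all of whose automorphisms extend is an
approximation (`isFiniteApproximation_of_extend`).

AZ-enumeration: if the fibres of `h : ℕ → ℕ` are finite of size congruent to `1`, their indicator
vectors are orthonormal, so `f ↦ f ∘ h` induces an endomorphism. It agrees with an automorphism on
each `G(n; K)`, hence is elementary. An element amounts to a word over `G ⧸ K` and an element of
`K`; words are ordered lexicographically from the far end. Higman's lemma, applied to words whose
letters also record counts modulo `2|G|` and the letters still to come, supplies an order preserving
`h` between two members of any sequence of tuples (`WordMerge.exists_merge`).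

Categoricity: an AZ-enumeration leaves only finitely many `n`-types, and back-and-forth does the
rest. -/

namespace FirstOrder.Language

variable {L : Language.{u, v}}

/-! ### Types, isolating formulas and one-step extension -/

section TypeAgree

variable {M N P : Type*} [L.Structure M] [L.Structure N] [L.Structure P] {α β : Type*}

variable (L) in
/-- Two tuples, of possibly different structures, satisfy the same formulas. -/
def TypeAgree (a : α → M) (b : α → N) : Prop :=
  ∀ φ : L.Formula α, φ.Realize a ↔ φ.Realize b

theorem TypeAgree.refl (a : α → M) : TypeAgree L a a := fun _ => Iff.rfl

theorem TypeAgree.symm {a : α → M} {b : α → N} (h : TypeAgree L a b) : TypeAgree L b a :=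
  fun φ => (h φ).symm

theorem TypeAgree.trans {a : α → M} {b : α → N} {c : α → P} (h : TypeAgree L a b)
    (h' : TypeAgree L b c) : TypeAgree L a c :=
  fun φ => (h φ).trans (h' φ)

theorem TypeAgree.comp {a : α → M} {b : α → N} (h : TypeAgree L a b) (g : β → α) :
    TypeAgree L (a ∘ g) (b ∘ g) := fun φ => by
  simpa [Formula.realize_relabel] using h (φ.relabel g)

theorem TypeAgree.eq_iff {a : α → M} {b : α → N} (h : TypeAgree L a b) (i j : α) :
    a i = a j ↔ b i = b j := by
  simpa [Formula.realize_equal] using h ((Term.var i).equal (Term.var j))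

theorem typeAgree_equiv (e : M ≃[L] N) (a : α → M) : TypeAgree L a (e ∘ a) :=
  fun φ => (StrongHomClass.realize_formula e φ).symm

variable (L M α) in
/-- Tuples satisfying the same formulas are identified. -/
def typeSetoid : Setoid (α → M) :=
  ⟨TypeAgree L, TypeAgree.refl, TypeAgree.symm, TypeAgree.trans⟩

/-- Each of the finitely many types other than that of `a` is excluded by one formula true of `a`;
the conjunction of these isolates the type. -/
theorem exists_isolating [Finite (Quotient (typeSetoid L M α))] (a : α → M) :
    ∃ φ : L.Formula α, φ.Realize a ∧ ∀ b : α → M, φ.Realize b → TypeAgree L a b := by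
  have h : ∀ q : Quotient (typeSetoid L M α), ∃ ψ : L.Formula α, ψ.Realize a ∧
      ∀ b : α → M, Quotient.mk _ b = q → ψ.Realize b → TypeAgree L a b := by
    intro q
    obtain ⟨c, rfl⟩ := Quotient.exists_rep q
    by_cases hc : TypeAgree L a c
    · refine ⟨⊤, by simp [Formula.Realize], fun b hb _ => hc.trans (Quotient.exact hb).symm⟩
    · simp only [TypeAgree, not_forall] at hc
      obtain ⟨ψ, hψ⟩ := hc
      by_cases ha : ψ.Realize a
      · refine ⟨ψ, ha, fun b hb hb' => (hψ ⟨fun _ => ?_, fun _ => ha⟩).elim⟩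
        exact ((Quotient.exact hb : TypeAgree L b c) ψ).1 hb'
      · refine ⟨ψ.not, by simpa using ha, fun b hb hb' => ?_⟩
        rw [Formula.realize_not] at hb'
        refine (hψ ⟨fun h => (ha h).elim, fun h => (hb' ?_).elim⟩).elim
        exact ((Quotient.exact hb : TypeAgree L b c) ψ).2 h
  choose ψ h1 h2 using h
  refine ⟨BoundedFormula.iInf ψ, ?_, fun b hb => h2 _ b rfl ?_⟩
  · simp only [Formula.Realize, BoundedFormula.realize_iInf]
    exact h1
  · simp only [Formula.Realize, BoundedFormula.realize_iInf] at hb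
    exact hb _

theorem finite_typeSetoid_of_fin (h : ∀ n, Finite (Quotient (typeSetoid L M (Fin n))))
    (α : Type*) [Finite α] : Finite (Quotient (typeSetoid L M α)) := by
  obtain ⟨n, ⟨e⟩⟩ := Finite.exists_equiv_fin α
  have := h n
  refine Finite.of_injective (β := Quotient (typeSetoid L M (Fin n)))
    (Quotient.map (fun a => a ∘ e.symm) fun a b hab => TypeAgree.comp hab _) ?_
  rintro ⟨a⟩ ⟨b⟩ hab
  refine Quotient.sound (show TypeAgree L a b from ?_)
  have := TypeAgree.comp (L := L) (Quotient.exact hab) e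
  simpa [Function.comp_assoc] using this

theorem forall_realize_iff_of_elementarilyEquivalent [Finite α]
    (h : ∀ σ : L.Sentence, M ⊨ σ ↔ N ⊨ σ) (φ : L.Formula α) :
    (∀ a : α → M, φ.Realize a) ↔ ∀ b : α → N, φ.Realize b := by
  have := h ((φ.relabel (Sum.inr : α → Empty ⊕ α)).iAlls α)
  simpa [Sentence.Realize, Formula.realize_iAlls, Formula.realize_relabel, Function.comp_def]
    using this

/-- In a structure elementarily equivalent to `M`, only types of `M` are realized, when there are
finitely many of them; moreover an isolating formula of `M` determines the type. -/
theorem exists_typeAgree_isolating [Finite α] [Finite (Quotient (typeSetoid L M α))]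
    (h : ∀ σ : L.Sentence, M ⊨ σ ↔ N ⊨ σ) (b : α → N) :
    ∃ φ : L.Formula α, φ.Realize b ∧ ∃ a : α → M, φ.Realize a ∧
      (∀ a' : α → M, φ.Realize a' → TypeAgree L a a') ∧
      (∀ b' : α → N, φ.Realize b' → TypeAgree L a b') := by
  choose φ h1 h2 using fun a : α → M => exists_isolating (L := L) a
  have h3 : ∃ q : Quotient (typeSetoid L M α), (φ q.out).Realize b := by
    have := (forall_realize_iff_of_elementarilyEquivalent h
      (BoundedFormula.iSup fun q : Quotient (typeSetoid L M α) => φ q.out : L.Formula α)).1 (by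
      intro a
      simp only [Formula.Realize, BoundedFormula.realize_iSup]
      refine ⟨Quotient.mk _ a, ?_⟩
      have : TypeAgree L (Quotient.mk (typeSetoid L M α) a).out a :=
        Quotient.exact (s := typeSetoid L M α) (Quotient.out_eq _)
      exact (this _).1 (h1 _)) b
    simpa only [Formula.Realize, BoundedFormula.realize_iSup] using this
  obtain ⟨q, hq⟩ := h3
  refine ⟨φ q.out, hq, q.out, h1 _, h2 _, fun b' hb' ψ => ?_⟩
  -- In `M` the isolating formula implies every formula of its type, and such implications transfer
  -- to `N`. Applying this to negations as well gives the equivalence.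
  have key : ∀ ψ : L.Formula α, ψ.Realize q.out → ψ.Realize b' := by
    intro ψ hψ
    have := (forall_realize_iff_of_elementarilyEquivalent h ((φ q.out).imp ψ)).1 (by
      intro a
      rw [Formula.realize_imp]
      exact fun ha => (h2 _ _ ha ψ).1 hψ) b'
    exact (Formula.realize_imp.1 this) hb'
  refine ⟨key ψ, fun hb => ?_⟩
  by_contra hn
  exact Formula.realize_not.1 (key ψ.not (Formula.realize_not.2 hn)) hb

theorem TypeAgree.exists_extend [Finite α] [Finite β]
    (hM : ∀ n, Finite (Quotient (typeSetoid L M (Fin n))))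
    (hN : ∀ σ : L.Sentence, M ⊨ σ ↔ N ⊨ σ) (hP : ∀ σ : L.Sentence, M ⊨ σ ↔ P ⊨ σ)
    {a : α → N} {b : α → P} (h : TypeAgree L a b) (c : β → N) :
    ∃ d : β → P, TypeAgree L (Sum.elim a c) (Sum.elim b d) := by
  have := finite_typeSetoid_of_fin hM (α ⊕ β)
  obtain ⟨φ, h1, e, h2, h3, h4⟩ := exists_typeAgree_isolating hN (Sum.elim a c)
  -- The existential closure of the isolating formula belongs to the common type of `a` and `b`.
  have h5 : (φ.iExs β).Realize b := by
    rw [← h, Formula.realize_iExs]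
    exact ⟨c, h1⟩
  rw [Formula.realize_iExs] at h5
  obtain ⟨d, hd⟩ := h5
  refine ⟨d, (h4 _ h1).symm.trans ?_⟩
  have h6 : ∀ ψ : L.Formula (α ⊕ β), ψ.Realize e → ψ.Realize (Sum.elim b d) := by
    intro ψ hψ
    have := (forall_realize_iff_of_elementarilyEquivalent hP (φ.imp ψ)).1 (by
      intro a
      rw [Formula.realize_imp]
      exact fun ha => (h3 _ ha ψ).1 hψ) (Sum.elim b d)
    exact (Formula.realize_imp.1 this) hd
  intro ψ
  refine ⟨h6 ψ, fun hb => ?_⟩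
  by_contra hn
  exact Formula.realize_not.1 (h6 ψ.not (Formula.realize_not.2 hn)) hb

/-- Atomic formulas include equalities and the graphs of the function symbols, so agreement on them
makes `a i ↦ b i` a well defined isomorphism. -/
theorem exists_equiv_of_surjective {a : α → M} {b : α → N} (ha : Function.Surjective a)
    (hb : Function.Surjective b)
    (h : ∀ (n : ℕ) (t : Fin n → α) (φ : L.Formula (Fin n)), φ.IsAtomic →
      (φ.Realize (a ∘ t) ↔ φ.Realize (b ∘ t))) :
    ∃ e : M ≃[L] N, ∀ i, e (a i) = b i := by
  have heq : ∀ i j, a i = a j ↔ b i = b j := by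
    intro i j
    simpa [Formula.realize_equal] using h 2 ![i, j] ((Term.var 0).equal (Term.var 1))
      (BoundedFormula.IsAtomic.equal _ _)
  choose s hs using ha
  choose r hr using hb
  have hbs : ∀ i, b (s (a i)) = b i := fun i => (heq _ _).1 (hs _)
  let e : M ≃ N := ⟨fun m => b (s m), fun n => a (r n), fun m =>
    ((heq _ _).2 (hr (b (s m)))).trans (hs m), fun n => (hbs _).trans (hr n)⟩
  have hcomp : ∀ {n} (x : Fin n → M), b ∘ (s ∘ x) = e ∘ x := fun x => rfl
  have hcomp' : ∀ {n} (x : Fin n → M), a ∘ (s ∘ x) = x := fun x => funext fun i => hs _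
  refine ⟨⟨e, fun {n} f x => ?_, fun {n} r x => ?_⟩, hbs⟩
  · have := h (n + 1) (Fin.snoc (s ∘ x) (s (Structure.funMap f x)))
      ((Term.func f fun i => Term.var i.castSucc).equal (Term.var (Fin.last n)))
      (BoundedFormula.IsAtomic.equal _ _)
    simp only [Formula.realize_equal, Term.realize_func, Term.realize_var, Function.comp_apply,
      Fin.snoc_castSucc, Fin.snoc_last, hs, true_iff] at this
    exact this.symm
  · have := h n (s ∘ x) (Relations.formula r fun i => Term.var i)
      (BoundedFormula.IsAtomic.rel _ _)
    rw [Formula.realize_rel, Formula.realize_rel] at this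
    simp only [Term.realize_var, hcomp, hcomp'] at this
    exact this.symm

end TypeAgree

/-! ### Back-and-forth and categoricity from finitely many types -/

section Categoricity

variable {M N : Type*} [L.Structure M] [L.Structure N]

variable (L M N) in
/-- Finite sets of pairs which are the graph of a partial elementary map. -/
def ElementaryPairs : Type _ :=
  {S : Finset (M × N) // TypeAgree L (fun p : S => p.1.1) (fun p : S => p.1.2)}

instance : PartialOrder (ElementaryPairs L M N) :=
  PartialOrder.lift Subtype.val Subtype.val_injective

theorem typeAgree_insert {S : Finset (M × N)} [DecidableEq (M × N)] {p : M × N}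
    (h : TypeAgree L (Sum.elim (fun p : S => p.1.1) fun _ : Unit => p.1)
      (Sum.elim (fun p : S => p.1.2) fun _ : Unit => p.2)) :
    TypeAgree L (fun p : (insert p S : Finset (M × N)) => p.1.1)
      (fun p : (insert p S : Finset (M × N)) => p.1.2) := by
  classical
  have := h.comp (fun x : (insert p S : Finset (M × N)) =>
    if hx : x.1 ∈ S then Sum.inl ⟨x.1, hx⟩ else Sum.inr ())
  convert this using 1
  all_goals
    funext x
    by_cases hx : x.1 ∈ S
    · simp [hx]
    · have : x.1 = p := (Finset.mem_insert.1 x.2).resolve_right hx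
      simp [this]
      simp [← this, hx]

theorem exists_equiv_of_finite_types {M₀ : Type*} [L.Structure M₀]
    (h : ∀ n, Finite (Quotient (typeSetoid L M₀ (Fin n))))
    (hM : ∀ σ : L.Sentence, M₀ ⊨ σ ↔ M ⊨ σ) (hN : ∀ σ : L.Sentence, M₀ ⊨ σ ↔ N ⊨ σ)
    [Countable M] [Countable N] : Nonempty (M ≃[L] N) := by
  classical
  have : Encodable M := Encodable.ofCountable M
  have : Encodable N := Encodable.ofCountable N
  have hMN : ∀ σ : L.Sentence, M ⊨ σ ↔ N ⊨ σ := fun σ => (hM σ).symm.trans (hN σ)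
  let p₀ : ElementaryPairs L M N := ⟨∅, by
    have : IsEmpty ((∅ : Finset (M × N)) : Type _) := ⟨fun x => Finset.notMem_empty _ x.2⟩
    have h0 := forall_realize_iff_of_elementarilyEquivalent
      (α := ((∅ : Finset (M × N)) : Type _)) hMN
    exact fun φ => ⟨fun h => (h0 φ).1 (fun a => Subsingleton.elim _ a ▸ h) _,
      fun h => (h0 φ).2 (fun a => Subsingleton.elim _ a ▸ h) _⟩⟩
  -- The back-and-forth requirements: each element of `M` or `N` is met by a cofinal family of
  -- finite partial maps. An ideal meeting all of them glues to an isomorphism.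
  let D : M ⊕ N → Order.Cofinal (ElementaryPairs L M N) := fun x =>
    { carrier := {S | match x with
        | Sum.inl m => ∃ n, (m, n) ∈ S.1
        | Sum.inr n => ∃ m, (m, n) ∈ S.1}
      isCofinal := by
        intro S
        obtain m | n := x
        · obtain ⟨d, hd⟩ := S.2.exists_extend h hM hN (fun _ : Unit => m)
          exact ⟨⟨insert (m, d ()) S.1, typeAgree_insert hd⟩,
            ⟨d (), Finset.mem_insert_self _ _⟩, Finset.subset_insert _ _⟩
        · obtain ⟨d, hd⟩ := S.2.symm.exists_extend h hN hM (fun _ : Unit => n)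
          exact ⟨⟨insert (d (), n) S.1, typeAgree_insert hd.symm⟩,
            ⟨d (), Finset.mem_insert_self _ _⟩, Finset.subset_insert _ _⟩ }
  let I := Order.idealOfCofinals p₀ D
  let A := {p : M × N // ∃ S ∈ I, p ∈ S.1}
  have hfin : ∀ n (t : Fin n → A), ∃ S ∈ I, ∀ i, (t i).1 ∈ S.1 := by
    intro n
    induction n with
    | zero => exact fun t => ⟨p₀, Order.mem_idealOfCofinals _ _, fun i => i.elim0⟩
    | succ n ih =>
      intro t
      obtain ⟨S, hS, h1⟩ := ih (fun i => t i.castSucc)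
      obtain ⟨S', hS', h2⟩ := (t (Fin.last n)).2
      obtain ⟨S'', hS'', h3, h4⟩ := I.directed S hS S' hS'
      exact ⟨S'', hS'', fun i => Fin.lastCases (h4 h2) (fun i => h3 (h1 i)) i⟩
  obtain ⟨e, -⟩ := exists_equiv_of_surjective (L := L) (a := fun p : A => p.1.1)
    (b := fun p : A => p.1.2)
    (fun m => by
      obtain ⟨S, ⟨n, hn⟩, hS⟩ := Order.cofinal_meets_idealOfCofinals p₀ D (Sum.inl m)
      exact ⟨⟨(m, n), S, hS, hn⟩, rfl⟩)
    (fun n => by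
      obtain ⟨S, ⟨m, hm⟩, hS⟩ := Order.cofinal_meets_idealOfCofinals p₀ D (Sum.inr n)
      exact ⟨⟨(m, n), S, hS, hm⟩, rfl⟩)
    (fun n t φ _ => by
      obtain ⟨S, _, hS⟩ := hfin n t
      exact S.2.comp (fun i => ⟨(t i).1, hS i⟩) φ)
  exact ⟨e⟩

theorem omegaCategorical_of_finite_types (M : Type w) [L.Structure M] [Countable M] [Infinite M]
    (h : ∀ n, Finite (Quotient (typeSetoid L M (Fin n)))) : OmegaCategorical L M := by
  refine ⟨inferInstance, inferInstance, fun A B hA hB => ?_⟩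
  have : Countable A := Cardinal.mk_le_aleph0_iff.1 hA.le
  have : Countable B := Cardinal.mk_le_aleph0_iff.1 hB.le
  exact exists_equiv_of_finite_types h (fun σ => (realize_iff_of_model_completeTheory M A σ).symm)
    (fun σ => (realize_iff_of_model_completeTheory M B σ).symm)

end Categoricity

/-! ### Finite substructures and extension of automorphisms -/

section Approximation

variable {M : Type*} [L.Structure M]

theorem finite_typeSetoid_of_finite (N α : Type*) [L.Structure N] [Finite N] [Finite α] :
    Finite (Quotient (typeSetoid L N α)) := inferInstance

/-- Extending the pair `a`, `b` by an enumeration of all of `N` gives an injective self-map of a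
finite set, hence an automorphism. -/
theorem TypeAgree.exists_equiv_of_finite {N α : Type*} [L.Structure N] [Finite N] [Finite α]
    {a b : α → N} (h : TypeAgree L a b) : ∃ z : N ≃[L] N, z ∘ a = b := by
  obtain ⟨d, hd⟩ := h.exists_extend (fun n => finite_typeSetoid_of_finite N (Fin n))
    (fun _ => Iff.rfl) (fun _ => Iff.rfl) (id : N → N)
  have h1 : TypeAgree L (id : N → N) d := hd.comp Sum.inr
  have hinj : Function.Injective d := fun i j hij => (h1.eq_iff i j).2 hij
  obtain ⟨z, hz⟩ := exists_equiv_of_surjective (L := L) (a := (id : N → N)) (b := d)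
    Function.surjective_id (Finite.surjective_of_injective hinj)
    (fun n t φ _ => h1.comp t φ)
  refine ⟨z, funext fun i => ?_⟩
  have := (hd.eq_iff (Sum.inl i) (Sum.inr (a i))).1 rfl
  exact (hz _).trans this.symm

/-- In a finite structure types are automorphism orbits, so an invariant set is a finite union of
isolated types. -/
theorem definable_of_invariant {N : Type*} [L.Structure N] [Finite N] {α : Type*} [Finite α]
    {R : Set (α → N)} (h : ∀ (z : N ≃[L] N) (x : α → N), x ∈ R → z ∘ x ∈ R) :
    (∅ : Set N).Definable L R := by
  have := finite_typeSetoid_of_finite (L := L) N α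
  choose φ h1 h2 using fun a : α → N => exists_isolating (L := L) a
  rw [Set.empty_definable_iff]
  refine ⟨(BoundedFormula.iSup fun x : R => φ x.1 : L.Formula α), ?_⟩
  ext x
  simp only [Set.mem_ofPred_eq, Formula.Realize, BoundedFormula.realize_iSup]
  refine ⟨fun hx => ⟨⟨x, hx⟩, h1 x⟩, ?_⟩
  rintro ⟨⟨y, hy⟩, hyx⟩
  obtain ⟨z, rfl⟩ := (h2 y x hyx).exists_equiv_of_finite
  exact h z y hy

/-- A finite substructure all of whose automorphisms extend is an approximation. -/
theorem isFiniteApproximation_of_extend (N : L.Substructure M) [Finite N]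
    (h : ∀ z : N ≃[L] N, ∃ σ : M ≃[L] M, ∀ x : N, σ x = z x) : IsFiniteApproximation N := by
  refine ⟨inferInstance, fun k R hR => ?_, fun k a b ha hb => ⟨fun hab => ?_, fun hab => ?_⟩⟩
  · rw [Set.empty_definable_iff] at hR
    obtain ⟨φ, rfl⟩ := hR
    refine definable_of_invariant fun z x hx => ?_
    obtain ⟨σ, hσ⟩ := h z
    have : (fun i => ((z ∘ x) i : M)) = σ ∘ fun i => (x i : M) := funext fun i => (hσ _).symm
    change φ.Realize _
    rw [this]
    exact (typeAgree_equiv σ _ φ).1 hx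
  · obtain ⟨z, rfl⟩ := TypeAgree.exists_equiv_of_finite (L := L) hab
    obtain ⟨σ, hσ⟩ := h z
    have : (fun i => ((z ∘ a) i : M)) = σ ∘ fun i => (a i : M) := funext fun i => (hσ _).symm
    rw [this]
    exact typeAgree_equiv σ _
  -- Here no extension is needed: atomic formulas are absolute between `N` and `M`, and they already
  -- determine an automorphism because `a` and `b` exhaust `N`.
  · have hab' : TypeAgree L (fun i => (a i : M)) (fun i => (b i : M)) := hab
    obtain ⟨z, hz⟩ := exists_equiv_of_surjective (L := L) ha hb (fun n t φ hφ => by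
      have key : ∀ y : Fin n → N, φ.Realize y ↔ φ.Realize fun i => (y i : M) := fun y => by
        have := hφ.isQF.realize_embedding (f := N.subtype) (v := y) (xs := default)
        rw [Formula.Realize, ← this, Formula.Realize]
        exact iff_of_eq (congrArg _ (Subsingleton.elim _ _))
      rw [key, key]
      exact hab'.comp t φ)
    have : b = z ∘ a := funext fun i => (hz i).symm
    rw [this]
    exact typeAgree_equiv z _

end Approximation

end FirstOrder.Language

/-! ### Generators and homomorphisms of central products -/

namespace CentralProduct

variable {G : Type u} [Group G] {A : Type v} {B : Type w} {K : Subgroup G}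

theorem restrictedPower_ext {f g : restrictedPower A G} (h : ∀ i, f.1 i = g.1 i) : f = g :=
  Subtype.ext (funext h)

theorem singleEntry_same (i : A) (x : G) : (singleEntry i x).1 i = x := by
  simp [singleEntry]

theorem singleEntry_of_ne {i j : A} (h : j ≠ i) (x : G) : (singleEntry i x).1 j = 1 := by
  simp [singleEntry, h]

variable (K) in
/-- The copy of `G` with index `i` in the central product. -/
noncomputable def copy (i : A) : G →* CentralProduct A K :=
  (QuotientGroup.mk' _).comp
    { toFun := singleEntry i
      map_one' := restrictedPower_ext fun j => by
        by_cases h : j = i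
        · subst h; simp [singleEntry_same]
        · simp [singleEntry_of_ne h]
      map_mul' := fun x y => restrictedPower_ext fun j => by
        by_cases h : j = i
        · subst h; simp [singleEntry_same]
        · simp [singleEntry_of_ne h] }

theorem copy_apply (i : A) (x : G) : copy K i x = QuotientGroup.mk (singleEntry i x) := rfl

theorem commute_copy {i j : A} (h : i ≠ j) (x y : G) : Commute (copy K i x) (copy K j y) := by
  have : Commute (singleEntry i x) (singleEntry j y) := by
    refine restrictedPower_ext fun l => ?_
    simp only [Subgroup.coe_mul, Pi.mul_apply]
    by_cases hi : l = i
    · subst hi; simp [singleEntry_of_ne h]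
    · simp [singleEntry_of_ne hi]
  exact this.map (QuotientGroup.mk' _)

theorem copy_eq_copy (hKZ : K ≤ Subgroup.center G) (i j : A) {k : G} (hk : k ∈ K) :
    copy K i k = copy K j k := by
  have : Nonempty A := ⟨i⟩
  rw [copy_apply, copy_apply, ← baseElement_eq hKZ ⟨k, hk⟩ i, ← baseElement_eq hKZ ⟨k, hk⟩ j]

theorem baseElement_eq_copy [Nonempty A] (hKZ : K ≤ Subgroup.center G) (k : K) (i : A) :
    baseElement A K k = copy K i (k : G) := baseElement_eq hKZ k i

theorem restrictedPower_hom_ext {H : Type*} [Monoid H] {f g : restrictedPower A G →* H}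
    (h : ∀ i x, f (singleEntry i x) = g (singleEntry i x)) : f = g := by
  classical
  have key : ∀ (s : Finset A) (x : restrictedPower A G), (∀ i ∉ s, x.1 i = 1) → f x = g x := by
    intro s
    induction s using Finset.induction_on with
    | empty =>
      intro x hx
      have : x = 1 := restrictedPower_ext fun i => by simpa using hx i (by simp)
      subst this
      exact (map_one f).trans (map_one g).symm
    | insert a s ha ih =>
      intro x hx
      obtain ⟨y, hy, hxy⟩ : ∃ y : restrictedPower A G, (∀ i ∉ s, y.1 i = 1) ∧
          x = y * singleEntry a (x.1 a) := by
        refine ⟨x * (singleEntry a (x.1 a))⁻¹, fun i hi => ?_, by simp⟩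
        by_cases h : i = a
        · subst h; simp [singleEntry_same]
        · simp [singleEntry_of_ne h, hx i (by simp [h, hi])]
      rw [hxy, map_mul, map_mul, ih y hy, h]
  ext x
  have hx : (Function.mulSupport x.1).Finite := x.2
  exact key hx.toFinset x fun i hi => by simpa using hi

theorem hom_ext {H : Type*} [Monoid H] {f g : CentralProduct A K →* H}
    (h : ∀ i x, f (copy K i x) = g (copy K i x)) : f = g :=
  QuotientGroup.monoidHom_ext _ (restrictedPower_hom_ext h)

/-! ### Ordered products and the universal property of `G(ω; K)` -/

section SeqProd

variable {H : Type*} [Group H]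

/-- The product of the first `n` terms of a sequence. -/
def seqProd (a : ℕ → H) : ℕ → H
  | 0 => 1
  | n + 1 => seqProd a n * a n

theorem seqProd_of_le {a : ℕ → H} {n m : ℕ} (h : ∀ i ≥ n, a i = 1) (hnm : n ≤ m) :
    seqProd a m = seqProd a n := by
  induction m, hnm using Nat.le_induction with
  | base => rfl
  | succ m hm ih => rw [seqProd, ih, h m hm, mul_one]

theorem seqProd_eq_one {a : ℕ → H} {n : ℕ} (h : ∀ i < n, a i = 1) : seqProd a n = 1 := by
  induction n with
  | zero => rfl
  | succ n ih => rw [seqProd, ih fun i hi => h i (by omega), h n (by omega), mul_one]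

theorem seqProd_eq {a : ℕ → H} {n m : ℕ} (h : ∀ i ≥ n, a i = 1) (h' : ∀ i ≥ m, a i = 1) :
    seqProd a m = seqProd a n := by
  rw [← seqProd_of_le h (le_max_left n m), ← seqProd_of_le h' (le_max_right n m)]

theorem commute_seqProd {a : ℕ → H} {c : H} {n : ℕ} (h : ∀ i < n, Commute (a i) c) :
    Commute (seqProd a n) c := by
  induction n with
  | zero => exact Commute.one_left c
  | succ n ih => exact (ih fun i hi => h i (by omega)).mul_left (h n (by omega))

theorem seqProd_mul {a b : ℕ → H} (h : ∀ i j, i ≠ j → Commute (a i) (b j)) (n : ℕ) :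
    seqProd (fun i => a i * b i) n = seqProd a n * seqProd b n := by
  induction n with
  | zero => simp [seqProd]
  | succ n ih =>
    have : Commute (seqProd b n) (a n) := commute_seqProd fun i hi => (h n i (by omega)).symm
    simp only [seqProd, ih]
    rw [mul_assoc, mul_assoc, ← mul_assoc (a n), ← this.eq, mul_assoc]

theorem map_seqProd {H' : Type*} [Group H'] (f : H →* H') (a : ℕ → H) (n : ℕ) :
    seqProd (fun i => f (a i)) n = f (seqProd a n) := by
  induction n with
  | zero => simp [seqProd]
  | succ n ih => simp [seqProd, ih]

theorem seqProd_eq_prod {C : Type*} [CommGroup C] (a : ℕ → C) (n : ℕ) :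
    seqProd a n = ∏ i ∈ Finset.range n, a i := by
  induction n with
  | zero => rfl
  | succ n ih => rw [seqProd, ih, Finset.prod_range_succ]

theorem exists_bound (f : restrictedPower ℕ G) : ∃ n, ∀ i ≥ n, f.1 i = 1 := by
  obtain ⟨n, hn⟩ := (f.2 : (Function.mulSupport f.1).Finite).bddAbove
  refine ⟨n + 1, fun i hi => ?_⟩
  by_contra h
  have := hn (Function.mem_mulSupport.2 h)
  omega

/-- Membership in the amalgamation kernel in terms of ordered products. -/
theorem mem_amalgamationKernel_iff (hKZ : K ≤ Subgroup.center G) {f : restrictedPower ℕ G} {n : ℕ}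
    (hn : ∀ i ≥ n, f.1 i = 1) :
    f ∈ amalgamationKernel ℕ K ↔ (∀ i, f.1 i ∈ K) ∧ seqProd f.1 n = 1 := by
  open scoped IsMulCommutative in
  have key : ∀ γ : ℕ → Subgroup.center G, (∀ i, (γ i : G) = f.1 i) →
      ((∏ᶠ i, γ i : Subgroup.center G) : G) = seqProd f.1 n := by
    intro γ h1
    rw [finprod_eq_prod_of_mulSupport_subset (s := Finset.range n) γ (by
      intro i hi
      by_contra h
      refine hi (Subtype.ext ?_)
      rw [h1, hn i (by simpa using h)]
      rfl), ← seqProd_eq_prod]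
    have := map_seqProd (Subgroup.center G).subtype γ n
    simp only [Subgroup.subtype_apply, h1] at this
    exact this.symm
  constructor
  · rintro ⟨γ, h1, h2, h3⟩
    exact ⟨h2, by rw [← key γ h1, h3]; rfl⟩
  · rintro ⟨h2, h3⟩
    refine ⟨fun i => ⟨f.1 i, hKZ (h2 i)⟩, fun i => rfl, h2, Subtype.ext ?_⟩
    rw [key _ fun i => rfl, h3]
    rfl

/-- The universal property of the central product `G(ω; K)`. -/
noncomputable def lift (φ : ℕ → G →* H)
    (hcomm : ∀ i j, i ≠ j → ∀ x y, Commute (φ i x) (φ j y))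
    (hK : ∀ i j, ∀ k ∈ K, φ i k = φ j k)
    (hKZ : K ≤ Subgroup.center G) : CentralProduct ℕ K →* H :=
  QuotientGroup.lift _ (MonoidHom.mk' (fun f : restrictedPower ℕ G =>
      seqProd (fun i => φ i (f.1 i)) (exists_bound f).choose) (by
    intro f g
    have hf := (exists_bound f).choose_spec
    have hg := (exists_bound g).choose_spec
    have hfg := (exists_bound (f * g)).choose_spec
    generalize (exists_bound f).choose = n at *
    generalize (exists_bound g).choose = m at *
    generalize (exists_bound (f * g)).choose = l at *
    let N := max n (max m l)
    rw [← seqProd_of_le (m := N) (fun i hi => by rw [hfg i hi, map_one]) (by omega),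
      ← seqProd_of_le (n := n) (m := N) (fun i hi => by rw [hf i hi, map_one]) (by omega),
      ← seqProd_of_le (n := m) (m := N) (fun i hi => by rw [hg i hi, map_one]) (by omega),
      ← seqProd_mul fun i j hij => hcomm i j hij _ _]
    simp)) (by
    intro f hf
    have hn := (exists_bound f).choose_spec
    change seqProd (fun i => φ i (f.1 i)) (exists_bound f).choose = 1
    generalize (exists_bound f).choose = n at *
    rw [mem_amalgamationKernel_iff hKZ hn] at hf
    -- On `K` all the `φ i` coincide, so the product is the image under `φ 0` of the trivial product
    -- of the entries.
    have : (fun i => φ i (f.1 i)) = fun i => φ 0 (f.1 i) :=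
      funext fun i => hK _ _ _ (hf.1 i)
    rw [this, map_seqProd, hf.2, map_one])

theorem lift_mk (φ : ℕ → G →* H)
    (hcomm : ∀ i j, i ≠ j → ∀ x y, Commute (φ i x) (φ j y))
    (hK : ∀ i j, ∀ k ∈ K, φ i k = φ j k)
    (hKZ : K ≤ Subgroup.center G) {f : restrictedPower ℕ G} {n : ℕ}
    (hn : ∀ i ≥ n, f.1 i = 1) :
    lift φ hcomm hK hKZ (QuotientGroup.mk f) = seqProd (fun i => φ i (f.1 i)) n :=
  seqProd_eq (fun i hi => by simp only [hn i hi, map_one])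
    (fun i hi => by simp only [(exists_bound f).choose_spec i hi, map_one])

theorem lift_copy (φ : ℕ → G →* H)
    (hcomm : ∀ i j, i ≠ j → ∀ x y, Commute (φ i x) (φ j y))
    (hK : ∀ i j, ∀ k ∈ K, φ i k = φ j k)
    (hKZ : K ≤ Subgroup.center G) (i : ℕ) (x : G) :
    lift φ hcomm hK hKZ (copy K i x) = φ i x := by
  rw [copy_apply, lift_mk φ hcomm hK hKZ (n := i + 1)
    fun j hj => singleEntry_of_ne (by omega) x, seqProd, singleEntry_same,
    seqProd_eq_one fun j hj => by rw [singleEntry_of_ne hj.ne, map_one], one_mul]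

end SeqProd

/-! ### Structure maps -/

theorem map_funMap [Nonempty A] [Nonempty B] (f : CentralProduct A K →* CentralProduct B K)
    (hf : ∀ k : K, f (baseElement A K k) = baseElement B K k) {n : ℕ}
    (F : (groupLanguage[[K]]).Functions n) (x : Fin n → CentralProduct A K) :
    f (Language.Structure.funMap F x) = Language.Structure.funMap F (f ∘ x) := by
  obtain F | F := F
  · cases F
    · exact map_mul f _ _
    · exact map_inv f _
    · exact map_one f
  · cases n with
    | zero => exact hf F
    | succ n => exact isEmptyElim (α := PEmpty) F

/-- An injective homomorphism over `K` is an embedding of structures. -/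
noncomputable def embeddingOfHom [Nonempty A] [Nonempty B]
    (f : CentralProduct A K →* CentralProduct B K) (hi : Function.Injective f)
    (hf : ∀ k : K, f (baseElement A K k) = baseElement B K k) :
    CentralProduct A K ↪[groupLanguage[[K]]] CentralProduct B K where
  toFun := f
  inj' := hi
  map_fun' := map_funMap f hf
  map_rel' := by
    rintro n (r | r)
    · exact r.elim
    · exact isEmptyElim r

/-- An isomorphism over `K` is an isomorphism of structures. -/
noncomputable def equivOfMulEquiv [Nonempty A] [Nonempty B]
    (f : CentralProduct A K ≃* CentralProduct B K)
    (hf : ∀ k : K, f (baseElement A K k) = baseElement B K k) :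
    CentralProduct A K ≃[groupLanguage[[K]]] CentralProduct B K where
  toEquiv := f.toEquiv
  map_fun' := map_funMap f.toMonoidHom hf
  map_rel' := by
    rintro n (r | r)
    · exact r.elim
    · exact isEmptyElim r

theorem equiv_map_mul [Nonempty A] [Nonempty B]
    (z : CentralProduct A K ≃[groupLanguage[[K]]] CentralProduct B K) (x y : CentralProduct A K) :
    z (x * y) = z x * z y :=
  z.map_fun (Sum.inl GroupFunc.mul : (groupLanguage[[K]]).Functions 2) ![x, y]

theorem equiv_map_baseElement [Nonempty A] [Nonempty B]
    (z : CentralProduct A K ≃[groupLanguage[[K]]] CentralProduct B K) (k : K) :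
    z (baseElement A K k) = baseElement B K k :=
  z.map_fun (Sum.inr k : (groupLanguage[[K]]).Functions 0) ![]

/-! ### The finite levels -/

theorem levelMap_copy {n : ℕ} (i : Fin n) (x : G) :
    levelMap K n (copy K i x) = copy K (i : ℕ) x := by
  have : extendPower G n (singleEntry i x) = singleEntry (i : ℕ) x := by
    refine restrictedPower_ext fun j => ?_
    by_cases h : ∃ a : Fin n, (a : ℕ) = j
    · obtain ⟨a, rfl⟩ := h
      refine (Fin.val_injective.extend_apply _ _ a).trans ?_
      by_cases h : a = i
      · subst h
        exact (singleEntry_same _ _).trans (singleEntry_same _ _).symm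
      · exact (singleEntry_of_ne h x).trans
          (singleEntry_of_ne (by simpa [Fin.ext_iff] using h) x).symm
    · refine (Function.extend_apply' _ _ _ h).trans ?_
      rw [singleEntry_of_ne]
      · rfl
      · rintro rfl
        exact h ⟨i, rfl⟩
  exact congrArg _ this

theorem levelMap_injective (n : ℕ) : Function.Injective (levelMap K n) := by
  open scoped IsMulCommutative in
  rw [injective_iff_map_eq_one]
  intro x
  induction x using QuotientGroup.induction_on with
  | H f =>
  intro hf
  rw [levelMap, QuotientGroup.map_mk, QuotientGroup.eq_one_iff] at hf
  rw [QuotientGroup.eq_one_iff]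
  obtain ⟨γ, h1, h2, h3⟩ := hf
  have hx : ∀ a : Fin n, (extendPower G n f).1 a = f.1 a := fun a =>
    Fin.val_injective.extend_apply _ _ a
  refine ⟨fun i => γ i, fun i => by rw [h1, hx], fun i => by rw [← hx]; exact h2 i, ?_⟩
  rw [← finprod_mem_range (f := γ) Fin.val_injective, ← h3, ← finprod_mem_univ (f := γ)]
  refine (finprod_mem_inter_mulSupport_eq _ _ _ ?_).symm
  rw [Set.univ_inter, eq_comm, Set.inter_eq_right]
  intro i hi
  by_contra h
  refine hi (Subtype.ext ?_)
  rw [h1]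
  exact Function.extend_apply' _ _ _ h

theorem levelMap_baseElement (hKZ : K ≤ Subgroup.center G) {n : ℕ} [NeZero n] (k : K) :
    levelMap K n (baseElement (Fin n) K k) = baseElement ℕ K k := by
  rw [baseElement_eq_copy hKZ k (0 : Fin n), levelMap_copy, ← baseElement_eq_copy hKZ]

/-- `G(n; K)` as a substructure embedding in `G(ω; K)`. -/
noncomputable def levelEmbedding (hKZ : K ≤ Subgroup.center G) (n : ℕ) [NeZero n] :
    CentralProduct (Fin n) K ↪[groupLanguage[[K]]] CentralProduct ℕ K :=
  embeddingOfHom (levelMap K n) (levelMap_injective n) (levelMap_baseElement hKZ)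

theorem exists_levelMap_eq {n : ℕ} {f : restrictedPower ℕ G} (hn : ∀ i ≥ n, f.1 i = 1) :
    ∃ y, levelMap K n y = QuotientGroup.mk f := by
  refine ⟨QuotientGroup.mk ⟨fun i => f.1 i, Set.toFinite _⟩, ?_⟩
  refine congrArg (QuotientGroup.mk (s := amalgamationKernel ℕ K)) ?_
  refine restrictedPower_ext fun j => ?_
  by_cases h : ∃ a : Fin n, (a : ℕ) = j
  · obtain ⟨a, rfl⟩ := h
    exact Fin.val_injective.extend_apply _ _ a
  · refine (Function.extend_apply' _ _ _ h).trans (hn j ?_).symm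
    by_contra hj
    exact h ⟨⟨j, by omega⟩, rfl⟩

theorem exists_level_of_finite {F : Set (CentralProduct ℕ K)} (hF : F.Finite) :
    ∃ n : ℕ, 0 < n ∧ F ⊆ Set.range (levelMap K n) := by
  have : ∀ x : CentralProduct ℕ K, ∃ n, ∀ m ≥ n, x ∈ Set.range (levelMap K m) := by
    intro x
    induction x using QuotientGroup.induction_on with
    | H f =>
    obtain ⟨n, hn⟩ := exists_bound f
    exact ⟨n, fun m hm => exists_levelMap_eq fun i hi => hn i (hm.trans hi)⟩
  choose b hb using this
  obtain ⟨m, hm⟩ := (hF.image b).bddAbove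
  exact ⟨m + 1, m.succ_pos, fun x hx => hb x _ ((hm ⟨x, hx, rfl⟩).trans m.le_succ)⟩

/-! ### Extending automorphisms of the finite levels -/

/-- Conjugation by an element of a later copy fixes the generating copies of the level, hence the
whole level. -/
theorem commute_levelMap {n i : ℕ} (hi : n ≤ i) (y : CentralProduct (Fin n) K) (x : G) :
    Commute (levelMap K n y) (copy K i x) := by
  have : (MulAut.conj (copy K i x)).toMonoidHom.comp (levelMap K n) = levelMap K n := by
    refine hom_ext fun j z => ?_
    have h : Commute (copy K i x) (copy K (j : ℕ) z) := commute_copy (by omega) _ _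
    simp [levelMap_copy, h.eq]
  have h := DFunLike.congr_fun this y
  simp only [MonoidHom.comp_apply] at h
  change copy K i x * levelMap K n y * (copy K i x)⁻¹ = _ at h
  exact (mul_inv_eq_iff_eq_mul.1 h).symm

section Extend

variable {n : ℕ} [NeZero n]

/-- The extension of an endomorphism of `G(n; K)` over `K` by the identity on the other copies. -/
noncomputable def extendHom (hKZ : K ≤ Subgroup.center G)
    (f : CentralProduct (Fin n) K →* CentralProduct (Fin n) K)
    (hf : ∀ k : K, f (baseElement _ K k) = baseElement _ K k) :
    CentralProduct ℕ K →* CentralProduct ℕ K :=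
  lift (fun i => if h : i < n then (levelMap K n).comp (f.comp (copy K ⟨i, h⟩)) else copy K i)
    (by
      intro i j hij x y
      by_cases hi : i < n <;> by_cases hj : j < n <;> simp only [hi, hj, dite_true, dite_false]
      · exact (((commute_copy (by simpa using hij) x y).map f).map (levelMap K n))
      · exact commute_levelMap (by omega) _ _
      · exact (commute_levelMap (by omega) _ _).symm
      · exact commute_copy hij x y)
    (by
      have : ∀ i, ∀ k ∈ K, (if h : i < n then (levelMap K n).comp (f.comp (copy K ⟨i, h⟩))
          else copy K i) k = copy K 0 k := by
        intro i k hk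
        by_cases hi : i < n <;> simp only [hi, dite_true, dite_false]
        · rw [MonoidHom.comp_apply, MonoidHom.comp_apply,
            ← baseElement_eq_copy hKZ ⟨k, hk⟩, hf, baseElement_eq_copy hKZ _ 0, levelMap_copy]
          rfl
        · exact copy_eq_copy hKZ _ _ hk
      intro i j k hk
      rw [this i k hk, this j k hk])
    hKZ

theorem extendHom_levelMap (hKZ : K ≤ Subgroup.center G)
    (f : CentralProduct (Fin n) K →* CentralProduct (Fin n) K)
    (hf : ∀ k : K, f (baseElement _ K k) = baseElement _ K k) (y : CentralProduct (Fin n) K) :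
    extendHom hKZ f hf (levelMap K n y) = levelMap K n (f y) := by
  have : (extendHom hKZ f hf).comp (levelMap K n) = (levelMap K n).comp f :=
    hom_ext fun i x => by simp [levelMap_copy, extendHom, lift_copy]
  exact DFunLike.congr_fun this y

theorem extendHom_copy_of_le (hKZ : K ≤ Subgroup.center G)
    (f : CentralProduct (Fin n) K →* CentralProduct (Fin n) K)
    (hf : ∀ k : K, f (baseElement _ K k) = baseElement _ K k) {i : ℕ} (hi : n ≤ i) (x : G) :
    extendHom hKZ f hf (copy K i x) = copy K i x := by
  simp [extendHom, lift_copy, hi.not_gt]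

theorem extendHom_comp (hKZ : K ≤ Subgroup.center G)
    {f g : CentralProduct (Fin n) K →* CentralProduct (Fin n) K}
    (hf : ∀ k : K, f (baseElement _ K k) = baseElement _ K k)
    (hg : ∀ k : K, g (baseElement _ K k) = baseElement _ K k)
    (hfg : ∀ x, f (g x) = x) :
    (extendHom hKZ f hf).comp (extendHom hKZ g hg) = MonoidHom.id _ := by
  refine hom_ext fun i x => ?_
  by_cases hi : i < n
  · have := levelMap_copy (K := K) ⟨i, hi⟩ x
    simp only at this
    simp [← this, extendHom_levelMap, hfg]
  · simp [extendHom_copy_of_le hKZ _ _ (not_lt.1 hi)]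

/-- The extensions of `z` and of its inverse by the identity on later copies are inverse to each
other. -/
theorem exists_extend_equiv (hKZ : K ≤ Subgroup.center G)
    (z : CentralProduct (Fin n) K ≃[groupLanguage[[K]]] CentralProduct (Fin n) K) :
    ∃ σ : CentralProduct ℕ K ≃[groupLanguage[[K]]] CentralProduct ℕ K,
      ∀ y, σ (levelMap K n y) = levelMap K n (z y) := by
  have hz := equiv_map_baseElement z
  have hz' := equiv_map_baseElement z.symm
  let f : CentralProduct (Fin n) K →* CentralProduct (Fin n) K :=
    MonoidHom.mk' z (equiv_map_mul z)
  let g : CentralProduct (Fin n) K →* CentralProduct (Fin n) K :=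
    MonoidHom.mk' z.symm (equiv_map_mul z.symm)
  refine ⟨equivOfMulEquiv (MonoidHom.toMulEquiv (extendHom hKZ f hz) (extendHom hKZ g hz')
    (extendHom_comp hKZ hz' hz fun x => z.symm_apply_apply x)
    (extendHom_comp hKZ hz hz' fun x => z.apply_symm_apply x)) fun k => ?_,
    extendHom_levelMap hKZ f hz⟩
  change extendHom hKZ f hz (baseElement ℕ K k) = baseElement ℕ K k
  rw [← levelMap_baseElement hKZ (n := n)]
  exact (extendHom_levelMap hKZ f hz _).trans (congrArg _ (hz k))

theorem isFiniteApproximation_level (hKZ : K ≤ Subgroup.center G)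
    [Finite G] :
    IsFiniteApproximation (levelEmbedding hKZ n).toHom.range := by
  have : Finite (restrictedPower (Fin n) G) := inferInstance
  have : Finite (CentralProduct (Fin n) K) := Quotient.finite _
  let e := (levelEmbedding hKZ n).equivRange
  have : Finite (levelEmbedding hKZ n).toHom.range := Finite.of_equiv _ e.toEquiv
  refine Language.isFiniteApproximation_of_extend _ fun z => ?_
  obtain ⟨σ, hσ⟩ := exists_extend_equiv hKZ ((e.symm.comp z).comp e)
  refine ⟨σ, fun x => ?_⟩
  obtain ⟨y, rfl⟩ := e.surjective x
  refine (hσ y).trans ?_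
  have : e (e.symm (z (e y))) = z (e y) := e.apply_symm_apply _
  exact congrArg Subtype.val this

end Extend

end CentralProduct

namespace CentralProduct

variable {G : Type u} [Group G] {K : Subgroup G}

/-! ### Powers in groups of class two -/

section ClassTwo

variable {x y c : G}

theorem zpow_mul_of_class_two (hc : ∀ g, Commute c g) (h : y * x = x * y * c) (n : ℤ) :
    y ^ n * x = x * y ^ n * c ^ n := by
  have h1 : x⁻¹ * y * x = y * c := by rw [mul_assoc, h]; group
  have h2 : x⁻¹ * y ^ n * x = y ^ n * c ^ n := by
    rw [← (hc y).symm.mul_zpow, ← h1]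
    simpa using (conj_zpow (a := x⁻¹) (b := y) (i := n)).symm
  rw [mul_assoc, ← h2]
  group

theorem zpow_mul_zpow_of_class_two (hc : ∀ g, Commute c g) (h : y * x = x * y * c) (n m : ℤ) :
    y ^ n * x ^ m = x ^ m * y ^ n * c ^ (m * n) := by
  have h1 := zpow_mul_of_class_two hc h n
  have h2 : x * y ^ n = y ^ n * x * (c ^ n)⁻¹ := by rw [h1]; group
  have h3 := zpow_mul_of_class_two (c := (c ^ n)⁻¹)
    (fun g => ((hc g).zpow_left n).inv_left) h2 m
  rw [h3, mul_assoc, inv_zpow, ← zpow_mul, mul_comm n m, inv_mul_cancel, mul_one]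

theorem mul_zpow_of_class_two (hc : ∀ g, Commute c g) (h : y * x = x * y * c) (n : ℤ) :
    (x * y) ^ n = x ^ n * y ^ n * c ^ (n * (n - 1) / 2) := by
  have hT : ∀ n : ℤ, (n + 1) * (n + 1 - 1) / 2 = n * (n - 1) / 2 + n := fun n => by
    have : (n + 1) * (n + 1 - 1) = n * (n - 1) + n * 2 := by ring
    rw [this, Int.add_mul_ediv_right _ _ two_ne_zero]
  have step : ∀ n : ℤ, x ^ (n + 1) * y ^ (n + 1) * c ^ ((n + 1) * (n + 1 - 1) / 2) =
      x ^ n * y ^ n * c ^ (n * (n - 1) / 2) * (x * y) := by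
    intro n
    have h1 := zpow_mul_of_class_two hc h n
    have h2 : Commute (c ^ (n * (n - 1) / 2)) (x * y) := (hc _).zpow_left _
    have h3 : Commute (c ^ n) y := (hc _).zpow_left _
    rw [mul_assoc _ (c ^ _) (x * y), h2.eq, ← mul_assoc, ← mul_assoc, mul_assoc _ _ x, h1, hT,
      zpow_add c, zpow_add_one, zpow_add_one]
    have h4 : Commute (c ^ (n * (n - 1) / 2)) (c ^ n) := (hc _).zpow_left _
    simp only [mul_assoc, h4.eq]
    rw [← mul_assoc y, ← h3.eq, mul_assoc]
  induction n with
  | zero => simp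
  | succ n ih => rw [zpow_add_one, ih, step]
  | pred n ih =>
    have := step (-n - 1)
    rw [sub_add_cancel, ← ih] at this
    rw [zpow_sub_one, this, mul_inv_cancel_right]

end ClassTwo

open scoped commutatorElement in
theorem exists_commutator (hGK : commutator G ≤ K) (hKZ : K ≤ Subgroup.center G) (x y : G) :
    ∃ c ∈ K, (∀ g, Commute c g) ∧ y * x = x * y * c := by
  have h : ⁅y⁻¹, x⁻¹⁆ ∈ K := hGK (Subgroup.commutator_mem_commutator (Subgroup.mem_top _) (Subgroup.mem_top _))
  refine ⟨⁅y⁻¹, x⁻¹⁆, h, fun g => (Subgroup.mem_center_iff.1 (hKZ h) g).symm, ?_⟩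
  rw [commutatorElement_def]
  group

/-! ### Families of powers of a fixed element -/

/-- The family of powers of `x` with exponents `v`. -/
def powFamily (v : ℕ →₀ ℤ) (x : G) : restrictedPower ℕ G :=
  ⟨fun i => x ^ v i, v.hasFiniteSupport.subset fun i hi => by
    simp only [Function.mem_mulSupport] at hi
    rw [Function.mem_support]
    intro h
    simp [h] at hi⟩

variable (K) in
/-- The class in `G(ω; K)` of the family of powers of `x` with exponents `v`. -/
def theta (v : ℕ →₀ ℤ) (x : G) : CentralProduct ℕ K := QuotientGroup.mk (powFamily v x)

theorem theta_add (v w : ℕ →₀ ℤ) (x : G) : theta K (v + w) x = theta K v x * theta K w x := by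
  have : powFamily (v + w) x = powFamily v x * powFamily w x :=
    restrictedPower_ext fun i => by simp [powFamily, zpow_add]
  rw [theta, this]
  rfl

theorem theta_zero (x : G) : theta K 0 x = 1 := by
  have : powFamily 0 x = 1 := restrictedPower_ext fun i => by simp [powFamily]
  rw [theta, this]
  rfl

theorem theta_zsmul (n : ℤ) (v : ℕ →₀ ℤ) (x : G) : theta K (n • v) x = theta K v (x ^ n) := by
  have : powFamily (n • v) x = powFamily v (x ^ n) :=
    restrictedPower_ext fun i => by simp [powFamily, zpow_mul]
  rw [theta, this, theta]

theorem theta_single (i : ℕ) (n : ℤ) (x : G) :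
    theta K (Finsupp.single i n) x = copy K i (x ^ n) := by
  have : powFamily (Finsupp.single i n) x = singleEntry i (x ^ n) :=
    restrictedPower_ext fun j => by
      by_cases h : j = i
      · subst h; simp [powFamily, singleEntry_same]
      · simp [powFamily, singleEntry_of_ne h, Finsupp.single_eq_of_ne h]
  rw [theta, this, copy_apply]

/-- The copies of `K` are amalgamated, so only the total exponent matters. -/
theorem theta_of_mem (hKZ : K ≤ Subgroup.center G) {k : G} (hk : k ∈ K) (v : ℕ →₀ ℤ) :
    theta K v k = copy K 0 (k ^ v.degree) := by
  induction v using Finsupp.induction_linear with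
  | zero => simp [theta_zero]
  | add v w hv hw => rw [theta_add, hv, hw, map_add, zpow_add, map_mul]
  | single i n =>
    rw [theta_single, Finsupp.degree_single, copy_eq_copy hKZ i 0 (K.zpow_mem hk n)]

theorem zpow_eq_one_of_dvd {n : ℤ} (h : (2 * Nat.card G : ℤ) ∣ n) (x : G) : x ^ n = 1 := by
  obtain ⟨m, rfl⟩ := h
  rw [mul_comm (2 : ℤ), mul_assoc, zpow_mul, zpow_natCast, pow_card_eq_one', one_zpow]

theorem theta_congr {v w r : ℕ →₀ ℤ} {n : ℤ} (hn : (2 * Nat.card G : ℤ) ∣ n)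
    (h : v = w + n • r) (x : G) : theta K v x = theta K w x := by
  have : theta K r (1 : G) = 1 := by simpa [theta_zero] using (theta_zsmul 0 r (1 : G) (K := K)).symm
  rw [h, theta_add, theta_zsmul, zpow_eq_one_of_dvd hn, this, mul_one]

/-- The commutator contributes exponents `v i (v i - 1) / 2`, with total `(v · v - ∑ v i) / 2`. It
must be divisible by `|G|`; the halving explains the modulus `2|G|`. -/
theorem theta_mul (hGK : commutator G ≤ K) (hKZ : K ≤ Subgroup.center G) {v : ℕ →₀ ℤ}
    (hv : (2 * Nat.card G : ℤ) ∣ (v * v).degree - v.degree) (x y : G) :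
    theta K v (x * y) = theta K v x * theta K v y := by
  obtain ⟨c, hcK, hc, hxy⟩ := exists_commutator hGK hKZ x y
  let t : ℕ →₀ ℤ := v.mapRange (fun n => n * (n - 1) / 2) (by simp)
  have h1 : powFamily v (x * y) = powFamily v x * powFamily v y * powFamily t c :=
    restrictedPower_ext fun i => mul_zpow_of_class_two hc hxy _
  have h2 : (2 : ℤ) • t = v * v - v := by
    ext i
    simp only [t, Finsupp.smul_apply, Finsupp.mapRange_apply, Finsupp.sub_apply,
      Finsupp.mul_apply, smul_eq_mul]
    rw [Int.mul_ediv_cancel' (Int.even_mul_pred_self _).two_dvd]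
    ring
  have h3 : (Nat.card G : ℤ) ∣ t.degree := by
    have := congrArg Finsupp.degree h2
    rw [map_sub, map_zsmul, smul_eq_mul] at this
    rw [← this] at hv
    exact Int.dvd_of_mul_dvd_mul_left two_ne_zero hv
  have h4 : theta K t c = 1 := by
    obtain ⟨m, hm⟩ := h3
    rw [theta_of_mem hKZ hcK, hm, zpow_mul, zpow_natCast, pow_card_eq_one', one_zpow, map_one]
  rw [theta, h1, QuotientGroup.mk_mul, QuotientGroup.mk_mul]
  exact (congrArg _ h4).trans (mul_one _)

/-- Exchanging the two families costs `c ^ (v i * w i)` at index `i`, and these add up to `c ^ (v ·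
w)` in `K`. -/
theorem commute_theta (hGK : commutator G ≤ K) (hKZ : K ≤ Subgroup.center G) {v w : ℕ →₀ ℤ}
    (h : (2 * Nat.card G : ℤ) ∣ (v * w).degree) (x y : G) :
    Commute (theta K v x) (theta K w y) := by
  obtain ⟨c, hcK, hc, hxy⟩ := exists_commutator hGK hKZ x y
  have h1 : powFamily w y * powFamily v x = powFamily v x * powFamily w y * powFamily (v * w) c :=
    restrictedPower_ext fun i => zpow_mul_zpow_of_class_two hc hxy _ _
  have h2 : theta K (v * w) c = 1 := by
    rw [theta_of_mem hKZ hcK, zpow_eq_one_of_dvd h, map_one]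
  have h3 : theta K w y * theta K v x = theta K v x * theta K w y * theta K (v * w) c :=
    congrArg QuotientGroup.mk h1
  rw [h2, mul_one] at h3
  exact h3.symm

/-! ### Orthonormal vectors and reflections -/

variable (G) in
/-- Vectors `v` with `v · v` and the sum of the entries congruent to `1`. -/
def IsNormal (v : ℕ →₀ ℤ) : Prop :=
  (2 * Nat.card G : ℤ) ∣ v.degree - 1 ∧ (2 * Nat.card G : ℤ) ∣ (v * v).degree - 1

theorem isNormal_single {G : Type u} (i : ℕ) : IsNormal G (Finsupp.single i 1) := by
  simp [IsNormal, ← Finsupp.single_mul]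

/-- A vector of norm one determines a homomorphism of `G` over `K`. -/
def thetaHom (hGK : commutator G ≤ K) (hKZ : K ≤ Subgroup.center G) {v : ℕ →₀ ℤ}
    (hv : IsNormal G v) : G →* CentralProduct ℕ K :=
  MonoidHom.mk' (theta K v) (theta_mul hGK hKZ (by
    simpa using dvd_sub hv.2 hv.1))

theorem theta_of_isNormal (hKZ : K ≤ Subgroup.center G) {v : ℕ →₀ ℤ} (hv : IsNormal G v)
    {k : G} (hk : k ∈ K) : theta K v k = copy K 0 k := by
  have : v.degree = 1 + (v.degree - 1) := by ring
  rw [theta_of_mem hKZ hk, this, zpow_add, zpow_eq_one_of_dvd hv.1, zpow_one, mul_one]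

/-- A sequence of orthonormal vectors determines an endomorphism of `G(ω; K)` over `K`. -/
noncomputable def orthoHom (hGK : commutator G ≤ K) (hKZ : K ≤ Subgroup.center G)
    (v : ℕ → ℕ →₀ ℤ) (hv : ∀ i, IsNormal G (v i))
    (hvv : ∀ i j, i ≠ j → (2 * Nat.card G : ℤ) ∣ (v i * v j).degree) :
    CentralProduct ℕ K →* CentralProduct ℕ K :=
  lift (fun i => thetaHom hGK hKZ (hv i))
    (fun i j hij x y => commute_theta hGK hKZ (hvv i j hij) x y)
    (fun i j _ hk => (theta_of_isNormal hKZ (hv i) hk).trans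
      (theta_of_isNormal hKZ (hv j) hk).symm) hKZ

section OrthoHom

variable (hGK : commutator G ≤ K) (hKZ : K ≤ Subgroup.center G)
    (v : ℕ → ℕ →₀ ℤ) (hv : ∀ i, IsNormal G (v i))
    (hvv : ∀ i j, i ≠ j → (2 * Nat.card G : ℤ) ∣ (v i * v j).degree)

theorem orthoHom_copy (i : ℕ) (x : G) :
    orthoHom hGK hKZ v hv hvv (copy K i x) = theta K (v i) x :=
  lift_copy _ _ _ hKZ i x

theorem orthoHom_baseElement (k : K) :
    orthoHom hGK hKZ v hv hvv (baseElement ℕ K k) = baseElement ℕ K k := by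
  rw [baseElement_eq_copy hKZ k 0, orthoHom_copy, theta_of_isNormal hKZ (hv 0) k.2]

theorem orthoHom_theta (w : ℕ →₀ ℤ) (x : G) :
    orthoHom hGK hKZ v hv hvv (theta K w x) = theta K (w.sum fun i n => n • v i) x := by
  induction w using Finsupp.induction_linear with
  | zero => simp [theta_zero]
  | add w w' h h' =>
    rw [theta_add, map_mul, h, h', ← theta_add, Finsupp.sum_add_index' (by simp)]
    simp [add_smul]
  | single i n => rw [theta_single, orthoHom_copy, Finsupp.sum_single_index (by simp), theta_zsmul]

end OrthoHom

/-- The reflection in a vector of norm two. -/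
noncomputable def reflect (r v : ℕ →₀ ℤ) : ℕ →₀ ℤ := v - (v * r).degree • r

theorem degree_smul_mul (n : ℤ) (v w : ℕ →₀ ℤ) : ((n • v) * w).degree = n * (v * w).degree := by
  rw [smul_mul_assoc, map_zsmul, smul_eq_mul]

theorem degree_reflect (r v : ℕ →₀ ℤ) :
    (reflect r v).degree = v.degree - (v * r).degree * r.degree := by
  rw [reflect, map_sub, map_zsmul, smul_eq_mul]

theorem degree_reflect_mul_reflect (r v w : ℕ →₀ ℤ) :
    (reflect r v * reflect r w).degree =
      (v * w).degree + (v * r).degree * (w * r).degree * ((r * r).degree - 2) := by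
  rw [reflect, reflect, sub_mul, mul_sub, mul_sub, map_sub, map_sub, map_sub, degree_smul_mul,
    degree_smul_mul, mul_comm v (_ • r), mul_comm r (_ • r), degree_smul_mul, degree_smul_mul,
    mul_comm r v, mul_comm r w]
  ring

theorem reflect_reflect (r v : ℕ →₀ ℤ) :
    reflect r (reflect r v) = v + ((v * r).degree * ((r * r).degree - 2)) • r := by
  have : (reflect r v * r).degree = (v * r).degree - (v * r).degree * (r * r).degree := by
    rw [reflect, sub_mul, map_sub, degree_smul_mul]
  rw [reflect, this, reflect]
  module

theorem reflect_eq_sum (r v : ℕ →₀ ℤ) :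
    (v.sum fun i n => n • reflect r (Finsupp.single i 1)) = reflect r v := by
  induction v using Finsupp.induction_linear with
  | zero => simp [reflect]
  | add w w' h h' =>
    rw [Finsupp.sum_add_index' (by simp) (by simp [add_smul]), h, h', reflect, reflect, reflect,
      add_mul, map_add, add_smul]
    abel
  | single i n =>
    have : Finsupp.single i n = n • Finsupp.single i (1 : ℤ) := by simp
    rw [Finsupp.sum_single_index (by simp), reflect, reflect, this, degree_smul_mul, smul_sub,
      smul_smul]

/-- The automorphism of `G(ω; K)` over `K` induced by a reflection. -/
theorem exists_reflection (hGK : commutator G ≤ K) (hKZ : K ≤ Subgroup.center G) {r : ℕ →₀ ℤ}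
    (h1 : (2 * Nat.card G : ℤ) ∣ r.degree) (h2 : (2 * Nat.card G : ℤ) ∣ (r * r).degree - 2) :
    ∃ σ : CentralProduct ℕ K ≃[groupLanguage[[K]]] CentralProduct ℕ K,
      ∀ v x, σ (theta K v x) = theta K (reflect r v) x := by
  let v : ℕ → ℕ →₀ ℤ := fun i => reflect r (Finsupp.single i 1)
  have hv : ∀ i, IsNormal G (v i) := fun i => by
    obtain ⟨h3, h4⟩ := isNormal_single (G := G) i
    refine ⟨?_, ?_⟩
    · rw [degree_reflect, sub_right_comm]
      exact dvd_sub h3 (h1.mul_left _)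
    · rw [degree_reflect_mul_reflect, add_sub_right_comm]
      exact dvd_add h4 (h2.mul_left _)
  have hvv : ∀ i j, i ≠ j → (2 * Nat.card G : ℤ) ∣ (v i * v j).degree := fun i j hij => by
    have : Finsupp.single i (1 : ℤ) * Finsupp.single j 1 = 0 := by
      ext l
      simp only [Finsupp.mul_apply, Finsupp.single_apply]
      grind
    rw [degree_reflect_mul_reflect, this, map_zero, zero_add]
    exact h2.mul_left _
  let f := orthoHom hGK hKZ v hv hvv
  have hf : ∀ w x, f (theta K w x) = theta K (reflect r w) x := fun w x => by
    rw [orthoHom_theta, reflect_eq_sum]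
  -- A reflection is an involution modulo `2|G|`, so `f` is its own inverse.
  have hff : f.comp f = MonoidHom.id _ := hom_ext fun i x => by
    have : copy K i x = theta K (Finsupp.single i 1) x := by rw [theta_single, zpow_one]
    rw [this, MonoidHom.comp_apply, hf, hf]
    exact theta_congr (h2.mul_left _) (reflect_reflect r _) x
  exact ⟨equivOfMulEquiv (MonoidHom.toMulEquiv f f hff hff)
    (orthoHom_baseElement hGK hKZ v hv hvv), hf⟩

theorem theta_reflect {r v : ℕ →₀ ℤ} {t : ℤ} (h : (2 * Nat.card G : ℤ) ∣ (v * r).degree - t)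
    (x : G) : theta K (reflect r v) x = theta K (v - t • r) x := by
  refine theta_congr h (r := -r) ?_ x
  rw [reflect]
  module

/-- Mutually orthogonal orthonormal systems are conjugate. -/
theorem exists_equiv_theta (hGK : commutator G ≤ K) (hKZ : K ≤ Subgroup.center G) {n : ℕ}
    (u v : ℕ → ℕ →₀ ℤ) (hu : ∀ i < n, IsNormal G (u i)) (hv : ∀ i < n, IsNormal G (v i))
    (huu : ∀ i < n, ∀ j < n, i ≠ j → (2 * Nat.card G : ℤ) ∣ (u i * u j).degree)
    (hvv : ∀ i < n, ∀ j < n, i ≠ j → (2 * Nat.card G : ℤ) ∣ (v i * v j).degree)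
    (huv : ∀ i < n, ∀ j < n, (2 * Nat.card G : ℤ) ∣ (u i * v j).degree) :
    ∃ σ : CentralProduct ℕ K ≃[groupLanguage[[K]]] CentralProduct ℕ K,
      ∀ i < n, ∀ x, σ (theta K (u i) x) = theta K (v i) x := by
  -- One vector is exchanged at a time: the reflection in `v m - u m` sends `u m` to `v m` and fixes
  -- the other vectors, which are orthogonal to both.
  have key : ∀ m ≤ n, ∃ σ : CentralProduct ℕ K ≃[groupLanguage[[K]]] CentralProduct ℕ K,
      ∀ i < n, ∀ x, σ (theta K (u i) x) = theta K (if i < m then v i else u i) x := by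
    intro m
    induction m with
    | zero => exact fun _ => ⟨Language.Equiv.refl _ _, fun i _ x => by simp⟩
    | succ m ih =>
      intro hm
      obtain ⟨σ, hσ⟩ := ih (by omega)
      have hm' : m < n := by omega
      obtain ⟨τ, hτ⟩ := exists_reflection hGK hKZ (r := v m - u m)
        (by simpa using dvd_sub (hv m hm').1 (hu m hm').1) (by
          have : ((v m - u m) * (v m - u m)).degree - 2 = ((v m * v m).degree - 1) +
              ((u m * u m).degree - 1) - 2 * (u m * v m).degree := by
            rw [sub_mul, mul_sub, mul_sub, map_sub, map_sub, map_sub, mul_comm (v m) (u m)]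
            ring
          rw [this]
          exact dvd_sub (dvd_add (hv m hm').2 (hu m hm').2) ((huv m hm' m hm').mul_left _))
      refine ⟨τ.comp σ, fun i hi x => ?_⟩
      rw [Language.Equiv.comp_apply, hσ i hi, hτ]
      have hsplit : ∀ w : ℕ →₀ ℤ, (w * (v m - u m)).degree = (w * v m).degree - (w * u m).degree :=
        fun w => by rw [mul_sub, map_sub]
      rcases lt_trichotomy i m with h | rfl | h
      · rw [if_pos h, if_pos (by omega), theta_reflect (t := 0)]
        · simp
        · rw [hsplit, sub_zero, mul_comm (v i) (u m)]
          exact dvd_sub (hvv i hi m hm' h.ne) (huv m hm' i hi)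
      · rw [if_neg (by omega), if_pos (by omega), theta_reflect (t := -1)]
        · simp
        · have h0 : (u i * (v i - u i)).degree - -1 =
              (u i * v i).degree - ((u i * u i).degree - 1) := by rw [hsplit]; ring
          rw [h0]
          exact dvd_sub (huv i hi i hi) (hu i hi).2
      · rw [if_neg (by omega), if_neg (by omega), theta_reflect (t := 0)]
        · simp
        · rw [hsplit, sub_zero]
          exact dvd_sub (huv i hi m hm') (huu i hi m hm' h.ne')
  obtain ⟨σ, hσ⟩ := key n le_rfl
  exact ⟨σ, fun i hi x => by rw [hσ i hi, if_pos hi]⟩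

end CentralProduct

namespace CentralProduct

variable {G : Type u} [Group G] {K : Subgroup G}

/-! ### Elementary maps from reindexing -/

variable (G) in
/-- Maps whose fibres are finite, of size congruent to `1`. -/
structure IsMerge (h : ℕ → ℕ) : Prop where
  finite : ∀ i, (h ⁻¹' {i}).Finite
  card : ∀ i, (2 * Nat.card G : ℤ) ∣ ((finite i).toFinset.card : ℤ) - 1

namespace IsMerge

variable {h : ℕ → ℕ}

/-- The indicator vector of a fibre. -/
noncomputable def fibre {G : Type u} (hh : IsMerge G h) (i : ℕ) : ℕ →₀ ℤ :=
  ∑ j ∈ (hh.finite i).toFinset, Finsupp.single j 1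

theorem fibre_apply {G : Type u} (hh : IsMerge G h) (i j : ℕ) :
    hh.fibre i j = if h j = i then 1 else 0 := by
  simp [fibre, Finsupp.finsetSum_apply, Finsupp.single_apply]

theorem fibre_mul_self {G : Type u} (hh : IsMerge G h) (i : ℕ) :
    hh.fibre i * hh.fibre i = hh.fibre i := by
  ext j
  simp [fibre_apply]

theorem fibre_mul_fibre {G : Type u} (hh : IsMerge G h) {i j : ℕ} (hij : i ≠ j) :
    hh.fibre i * hh.fibre j = 0 := by
  ext l
  simp only [Finsupp.mul_apply, fibre_apply, Finsupp.zero_apply]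
  grind

theorem isNormal_fibre {G : Type u} (hh : IsMerge G h) (i : ℕ) : IsNormal G (hh.fibre i) := by
  have : (hh.fibre i).degree = ((hh.finite i).toFinset.card : ℤ) := by
    simp [fibre, map_sum, Finsupp.degree_single]
  rw [IsNormal, fibre_mul_self, this, and_self]
  exact hh.card i

/-- Reindexing of families. -/
def reindex {G : Type u} [Group G] (hh : IsMerge G h) : restrictedPower ℕ G →* restrictedPower ℕ G where
  toFun f := ⟨fun j => f.1 (h j), by
    have hf : (Function.mulSupport f.1).Finite := f.2
    exact (hf.preimage' fun i _ => hh.finite i).subset fun j hj => hj⟩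
  map_one' := rfl
  map_mul' _ _ := rfl

variable (hGK : commutator G ≤ K) (hKZ : K ≤ Subgroup.center G) (hh : IsMerge G h)

/-- The endomorphism of `G(ω; K)` over `K` induced by reindexing. -/
noncomputable def hom : CentralProduct ℕ K →* CentralProduct ℕ K :=
  orthoHom hGK hKZ hh.fibre hh.isNormal_fibre
    fun i j hij => by rw [hh.fibre_mul_fibre hij, map_zero]; exact dvd_zero _

theorem hom_mk (f : restrictedPower ℕ G) :
    hh.hom hGK hKZ (QuotientGroup.mk f) = QuotientGroup.mk (hh.reindex f) := by
  have : (hh.hom hGK hKZ).comp (QuotientGroup.mk' (amalgamationKernel ℕ K)) =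
      (QuotientGroup.mk' (amalgamationKernel ℕ K)).comp hh.reindex := by
    refine restrictedPower_hom_ext fun i x => ?_
    have h1 : powFamily (hh.fibre i) x = hh.reindex (singleEntry i x) :=
      restrictedPower_ext fun j => by
        by_cases hj : h j = i
        · subst hj
          simp [powFamily, fibre_apply, reindex, singleEntry_same]
        · simp [powFamily, fibre_apply, reindex, hj, singleEntry_of_ne hj]
    rw [MonoidHom.comp_apply, MonoidHom.comp_apply, ← h1]
    exact orthoHom_copy hGK hKZ _ _ _ i x
  exact DFunLike.congr_fun this f

theorem hom_baseElement (k : K) : hh.hom hGK hKZ (baseElement ℕ K k) = baseElement ℕ K k :=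
  orthoHom_baseElement _ _ _ _ _ k

theorem exists_equiv_eqOn (n : ℕ) :
    ∃ σ : CentralProduct ℕ K ≃[groupLanguage[[K]]] CentralProduct ℕ K,
      ∀ x ∈ Set.range (levelMap K n), σ x = hh.hom hGK hKZ x := by
  -- The unit vectors at `0, …, n - 1` need not be orthogonal to the fibres. The unit vectors from
  -- `N` on are orthogonal to both, so the move is made in two stages through them.
  obtain ⟨N, hnN, hN⟩ : ∃ N, n ≤ N ∧ ∀ j ≥ N, n ≤ h j := by
    obtain ⟨B, hB⟩ := ((Set.finite_lt_nat n).preimage' fun i _ => hh.finite i).bddAbove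
    refine ⟨max n (B + 1), le_max_left _ _, fun j hj => ?_⟩
    by_contra hn
    have := hB (show j ∈ h ⁻¹' {i | i < n} by simpa using hn)
    omega
  have hs : ∀ i j : ℕ, i ≠ j → (Finsupp.single i 1 * Finsupp.single j 1 : ℕ →₀ ℤ) = 0 := by
    intro i j hij
    ext l
    simp only [Finsupp.mul_apply, Finsupp.single_apply]
    grind
  obtain ⟨σ, hσ⟩ := exists_equiv_theta (n := n) hGK hKZ (fun i => Finsupp.single i 1)
    (fun i => Finsupp.single (N + i) 1) (fun i _ => isNormal_single i) (fun i _ => isNormal_single _)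
    (fun i _ j _ hij => by rw [hs i j hij]; simp)
    (fun i _ j _ hij => by rw [hs _ _ (by omega)]; simp)
    (fun i _ j _ => by rw [hs _ _ (by omega)]; simp)
  obtain ⟨τ, hτ⟩ := exists_equiv_theta (n := n) hGK hKZ (fun i => Finsupp.single (N + i) 1)
    hh.fibre (fun i _ => isNormal_single _) (fun i _ => hh.isNormal_fibre i)
    (fun i _ j _ hij => by rw [hs _ _ (by omega)]; simp)
    (fun i _ j _ hij => by rw [hh.fibre_mul_fibre hij]; simp)
    (fun i _ j hj => by
      have : (Finsupp.single (N + i) 1 * hh.fibre j : ℕ →₀ ℤ) = 0 := by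
        ext l
        simp only [Finsupp.mul_apply, Finsupp.single_apply, fibre_apply, Finsupp.zero_apply]
        have := hN (N + i) (by omega)
        grind
      rw [this]
      simp)
  refine ⟨τ.comp σ, ?_⟩
  rintro _ ⟨y, rfl⟩
  have : (MonoidHom.mk' (τ.comp σ) (equiv_map_mul (τ.comp σ))).comp (levelMap K n) =
      (hh.hom hGK hKZ).comp (levelMap K n) := by
    refine hom_ext fun i x => ?_
    have h1 := hσ i i.2 x
    rw [theta_single, zpow_one] at h1
    rw [MonoidHom.comp_apply, MonoidHom.comp_apply, levelMap_copy, MonoidHom.mk'_apply,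
      Language.Equiv.comp_apply, h1, hτ i i.2]
    exact (orthoHom_copy hGK hKZ _ _ _ _ x).symm
  exact DFunLike.congr_fun this y

/-- Reindexing is elementary, also with constants for the elements of `K`. -/
noncomputable def elementaryEmbedding :
    CentralProduct ℕ K ↪ₑ[groupLanguage[[K]]] CentralProduct ℕ K where
  toFun := hh.hom hGK hKZ
  map_formula' := by
    intro n φ x
    -- A formula sees only a finite tuple, which lies in a level where the map agrees with an
    -- automorphism.
    obtain ⟨m, -, hm⟩ := exists_level_of_finite (Set.finite_range x)
    obtain ⟨σ, hσ⟩ := hh.exists_equiv_eqOn hGK hKZ m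
    have : hh.hom hGK hKZ ∘ x = σ ∘ x := funext fun i => (hσ _ (hm ⟨i, rfl⟩)).symm
    rw [this]
    exact Language.StrongHomClass.realize_formula σ φ

end IsMerge

/-! ### Coordinates -/

section Coordinates

/-- The sequence of cosets of an element of `G(ω; K)`. -/
def shape [K.Normal] : CentralProduct ℕ K →* (ℕ → G ⧸ K) :=
  QuotientGroup.lift _ (MonoidHom.mk' (fun f i => (f.1 i : G ⧸ K)) fun _ _ => rfl) (by
    rintro f ⟨_, _, h, _⟩
    exact funext fun i => (QuotientGroup.eq_one_iff _).2 (h i))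

theorem shape_mk [K.Normal] (f : restrictedPower ℕ G) (i : ℕ) :
    shape (K := K) (QuotientGroup.mk f) i = (f.1 i : G ⧸ K) := rfl

theorem exists_bound_shape [K.Normal] (x : CentralProduct ℕ K) :
    ∃ n, ∀ i ≥ n, shape x i = 1 := by
  induction x using QuotientGroup.induction_on with
  | H f =>
  obtain ⟨n, hn⟩ := exists_bound f
  exact ⟨n, fun i hi => by rw [shape_mk, hn i hi]; rfl⟩

theorem exists_section (K : Subgroup G) [K.Normal] :
    ∃ s : G ⧸ K → G, s 1 = 1 ∧ ∀ c, (s c : G ⧸ K) = c := by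
  classical
  refine ⟨fun c => if c = 1 then 1 else c.out, by simp, fun c => ?_⟩
  by_cases h : c = 1
  · simp [h]
  · simp [h]

/-- The family of representatives of the cosets of an element of `G(ω; K)`. -/
def repFamily [K.Normal] {s : G ⧸ K → G} (hs : s 1 = 1) (x : CentralProduct ℕ K) :
    restrictedPower ℕ G :=
  ⟨fun i => s (shape x i), by
    obtain ⟨n, hn⟩ := exists_bound_shape x
    refine (Set.finite_lt_nat n).subset fun i hi => ?_
    by_contra h
    exact hi (by simp [hn i (not_lt.1 h), hs])⟩

theorem baseElement_injective (hKZ : K ≤ Subgroup.center G) :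
    Function.Injective (baseElement ℕ K) := by
  intro k k' h
  rw [baseElement_eq_copy hKZ k 0, baseElement_eq_copy hKZ k' 0, ← inv_mul_eq_one, ← map_inv,
    ← map_mul, copy_apply, QuotientGroup.eq_one_iff, mem_amalgamationKernel_iff hKZ (n := 1)
    fun i hi => singleEntry_of_ne (by omega) _] at h
  have := h.2
  rw [seqProd, singleEntry_same] at this
  exact Subtype.ext (inv_mul_eq_one.1 (by simpa [seqProd] using this))

/-- A family with all entries in `K` differs by an element of the amalgamation kernel from the one
concentrating its product at index `0`. -/
theorem exists_baseElement_of_shape (hKZ : K ≤ Subgroup.center G) [K.Normal]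
    {x : CentralProduct ℕ K} (hx : shape x = 1) : ∃ k : K, x = baseElement ℕ K k := by
  induction x using QuotientGroup.induction_on with
  | H f =>
  have hf : ∀ i, f.1 i ∈ K := fun i => (QuotientGroup.eq_one_iff _).1 (congrFun hx i)
  obtain ⟨n, hn⟩ := exists_bound f
  have hp : ∀ m, seqProd f.1 m ∈ K := fun m => by
    induction m with
    | zero => exact K.one_mem
    | succ m ih => exact K.mul_mem ih (hf m)
  refine ⟨⟨seqProd f.1 n, hp n⟩, ?_⟩
  have hn' : ∀ i ≥ max n 1, (f * (singleEntry 0 (seqProd f.1 n))⁻¹).1 i = 1 := fun i hi => by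
    simp [hn i (by omega), singleEntry_of_ne (show i ≠ 0 by omega)]
  rw [baseElement_eq hKZ _ 0, ← mul_inv_eq_one, ← QuotientGroup.mk_inv, ← QuotientGroup.mk_mul,
    QuotientGroup.eq_one_iff, mem_amalgamationKernel_iff hKZ hn']
  have hs : ∀ i, (singleEntry 0 (seqProd f.1 n)).1 i ∈ K := fun i => by
    by_cases h : i = 0
    · subst h; rw [singleEntry_same]; exact hp n
    · rw [singleEntry_of_ne h]; exact K.one_mem
  refine ⟨fun i => K.mul_mem (hf i) (K.inv_mem (hs i)), ?_⟩
  have h1 := seqProd_mul (a := f.1) (b := fun i => ((singleEntry 0 (seqProd f.1 n)).1 i)⁻¹)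
    (fun i j _ => Subgroup.mem_center_iff.1 (hKZ (K.inv_mem (hs j))) _) (max n 1)
  refine h1.trans ?_
  rw [seqProd_of_le hn (le_max_left n 1), seqProd_of_le (n := 1) (m := max n 1)
    (fun i hi => by rw [singleEntry_of_ne (by omega), inv_one]) (le_max_right n 1)]
  simp [seqProd, singleEntry_same]

theorem exists_eq_rep_mul_base (hKZ : K ≤ Subgroup.center G) [K.Normal] {s : G ⧸ K → G}
    (hs : s 1 = 1) (hs' : ∀ c, (s c : G ⧸ K) = c) (x : CentralProduct ℕ K) :
    ∃ k : K, x = QuotientGroup.mk (repFamily hs x) * baseElement ℕ K k := by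
  obtain ⟨k, hk⟩ := exists_baseElement_of_shape hKZ
    (x := (QuotientGroup.mk (repFamily hs x))⁻¹ * x) (by
    rw [map_mul, map_inv, inv_mul_eq_one]
    exact funext fun i => hs' _)
  exact ⟨k, by rw [← hk, mul_inv_cancel_left]⟩

/-- Elements of `G(ω; K)` have coordinates in `G ⧸ K` and in `K`, which reindexing respects. -/
theorem exists_coordinates (hGK : commutator G ≤ K) (hKZ : K ≤ Subgroup.center G) [K.Normal] :
    ∃ κ : CentralProduct ℕ K → K,
      (∀ x y, shape x = shape y → κ x = κ y → x = y) ∧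
      ∀ (h : ℕ → ℕ) (hh : IsMerge G h) (x : CentralProduct ℕ K),
        shape (hh.hom hGK hKZ x) = shape x ∘ h ∧ κ (hh.hom hGK hKZ x) = κ x := by
  obtain ⟨s, hs, hs'⟩ := exists_section K
  choose κ hκ using exists_eq_rep_mul_base hKZ hs hs'
  have hrep : ∀ x y : CentralProduct ℕ K, shape x = shape y → repFamily hs x = repFamily hs y :=
    fun x y h => restrictedPower_ext fun i => congrArg s (congrFun h i)
  refine ⟨κ, fun x y h h' => by rw [hκ x, hκ y, hrep x y h, h'], fun h hh x => ?_⟩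
  have h1 : shape (hh.hom hGK hKZ x) = shape x ∘ h := by
    induction x using QuotientGroup.induction_on with
    | H f => rw [hh.hom_mk]; rfl
  refine ⟨h1, ?_⟩
  -- Representatives are chosen coset by coset, independently of the index, so reindexing preserves
  -- families of representatives and leaves the `K`-part alone.
  have h2 : hh.reindex (repFamily hs x) = repFamily hs (hh.hom hGK hKZ x) :=
    restrictedPower_ext fun i => congrArg s (congrFun h1 i).symm
  have h3 := congrArg (hh.hom hGK hKZ) (hκ x)
  rw [map_mul, hh.hom_mk, hh.hom_baseElement, h2] at h3
  exact baseElement_injective hKZ (mul_left_cancel ((hκ _).symm.trans h3))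

end Coordinates

end CentralProduct

/-! ### Well-quasi-ordering of words -/

namespace WordMerge

variable {S : Type*} {u v : ℕ → S} {f : ℕ → ℕ}

theorem exists_lt (hf : StrictMono f) (j : ℕ) : ∃ i, j < f i := ⟨j + 1, hf.le_apply⟩

open Classical in
/-- The index of the gap of `f` containing `j`. -/
noncomputable def gap (hf : StrictMono f) (j : ℕ) : ℕ := Nat.find (exists_lt hf j)

theorem lt_gap (hf : StrictMono f) (j : ℕ) : j < f (gap hf j) := by
  classical exact Nat.find_spec (exists_lt hf j)

theorem le_of_lt_gap (hf : StrictMono f) {i j : ℕ} (h : i < gap hf j) : f i ≤ j := by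
  classical exact not_lt.1 (Nat.find_min (exists_lt hf j) h)

theorem gap_eq_iff (hf : StrictMono f) {g j : ℕ} :
    j ∉ Set.range f ∧ gap hf j = g ↔ j < f g ∧ ∀ i < g, f i < j := by
  constructor
  · rintro ⟨h, rfl⟩
    exact ⟨lt_gap hf j, fun i hi => (le_of_lt_gap hf hi).lt_of_ne fun e => h ⟨i, e⟩⟩
  · rintro ⟨h1, h2⟩
    refine ⟨?_, le_antisymm (not_lt.1 fun h => ?_) (not_lt.1 fun h => ?_)⟩
    · rintro ⟨i, rfl⟩
      exact lt_irrefl _ (h2 i (hf.lt_iff_lt.1 h1))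
    · exact absurd h1 (not_lt.2 (le_of_lt_gap hf h))
    · exact lt_asymm (lt_gap hf j) (h2 _ h)

open Classical in
/-- Leftover positions are sent to a later occurrence of the same letter. -/
noncomputable def target (u : ℕ → S) (g : ℕ) (s : S) : ℕ :=
  if h : ∃ i ≥ g, u i = s then h.choose else g

theorem target_spec {g : ℕ} {s : S} (h : ∃ i ≥ g, u i = s) :
    g ≤ target u g s ∧ u (target u g s) = s := by
  rw [target, dif_pos h]
  exact h.choose_spec

open Classical in
/-- The merging map attached to a strictly increasing map. -/
noncomputable def merge (u v : ℕ → S) (hf : StrictMono f) (j : ℕ) : ℕ :=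
  if h : j ∈ Set.range f then h.choose else target u (gap hf j) (v j)

theorem merge_apply (hf : StrictMono f) (i : ℕ) : merge u v hf (f i) = i := by
  have h : f i ∈ Set.range f := ⟨i, rfl⟩
  rw [merge, dif_pos h]
  exact hf.injective h.choose_spec

theorem merge_of_notMem (hf : StrictMono f) {j : ℕ} (h : j ∉ Set.range f) :
    merge u v hf j = target u (gap hf j) (v j) := by
  rw [merge, dif_neg h]

theorem le_apply_merge (hf : StrictMono f)
    (hA : ∀ j ∉ Set.range f, ∃ i ≥ gap hf j, u i = v j) (j : ℕ) : j ≤ f (merge u v hf j) := by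
  by_cases h : j ∈ Set.range f
  · obtain ⟨i, rfl⟩ := h
    rw [merge_apply]
  · rw [merge_of_notMem hf h]
    exact (lt_gap hf j).le.trans (hf.monotone (target_spec (hA j h)).1)

theorem comp_merge (hf : StrictMono f) (huv : ∀ i, v (f i) = u i)
    (hA : ∀ j ∉ Set.range f, ∃ i ≥ gap hf j, u i = v j) (j : ℕ) : u (merge u v hf j) = v j := by
  by_cases h : j ∈ Set.range f
  · obtain ⟨i, rfl⟩ := h
    rw [merge_apply, huv]
  · rw [merge_of_notMem hf h]
    exact (target_spec (hA j h)).2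

/-- The fibre over `i` is `f i` together with leftover positions. Their target depends only on gap
and letter, so they form whole classes, each of size divisible by `q`. -/
theorem dvd_card_fibre {q : ℕ} (hf : StrictMono f)
    (hB : ∀ j ∉ Set.range f, ∀ T : Finset ℕ,
      (∀ l, l ∈ T ↔ l ∉ Set.range f ∧ gap hf l = gap hf j ∧ v l = v j) → q ∣ T.card)
    (i : ℕ) (F : Finset ℕ) (hF : ∀ j, j ∈ F ↔ merge u v hf j = i) :
    (q : ℤ) ∣ (F.card : ℤ) - 1 := by
  classical
  have hi : f i ∈ F := (hF _).2 (merge_apply hf i)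
  rw [← Finset.card_erase_add_one hi, Nat.cast_add_one, add_sub_cancel_right, Int.natCast_dvd_natCast]
  have hr : ∀ j ∈ F.erase (f i), j ∉ Set.range f := by
    rintro _ hj ⟨l, rfl⟩
    obtain ⟨h1, h2⟩ := Finset.mem_erase.1 hj
    rw [hF, merge_apply] at h2
    exact h1 (congrArg f h2)
  rw [Finset.card_eq_sum_card_image fun j => (gap hf j, v j)]
  refine Finset.dvd_sum fun p hp => ?_
  obtain ⟨j, hj, rfl⟩ := Finset.mem_image.1 hp
  refine hB j (hr j hj) _ fun l => ?_
  rw [Finset.mem_filter, Prod.mk.injEq]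
  refine ⟨fun h => ⟨hr l h.1, h.2⟩, fun h => ⟨Finset.mem_erase.2 ⟨?_, ?_⟩, h.2⟩⟩
  · rintro rfl
    exact h.1 ⟨i, rfl⟩
  · have := (hF j).1 (Finset.mem_of_mem_erase hj)
    rw [merge_of_notMem hf (hr j hj)] at this
    rw [hF, merge_of_notMem hf h.1, h.2.1, h.2.2, this]

open Classical in
/-- The annotation of position `j` in the word formed by the first `n` letters of `w`. -/
noncomputable def annotate (q : ℕ) (w : ℕ → S) (n j : ℕ) : S × (S → ZMod q) × Set S :=
  (w j, fun s => (Nat.count (fun i => w i = s) j : ZMod q), {s | ∃ i, j < i ∧ i < n ∧ w i = s})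

open Classical in
theorem count_gap (p : ℕ → Prop) {a b : ℕ} (hab : a < b) (T : Finset ℕ)
    (hT : ∀ l, l ∈ T ↔ a < l ∧ l < b ∧ p l) :
    Nat.count p b = Nat.count p a + (if p a then 1 else 0) + T.card := by
  rw [← Nat.count_succ, Nat.count_eq_card_filter_range, Nat.count_eq_card_filter_range,
    ← Finset.card_union_of_disjoint]
  · congr 1
    ext l
    simp only [Finset.mem_filter, Finset.mem_range, Finset.mem_union, hT]
    grind
  · rw [Finset.disjoint_left]
    intro l hl
    simp only [Finset.mem_filter, Finset.mem_range] at hl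
    rw [hT]
    omega

/-- Equal counts modulo `q` at both ends of a gap make each letter occur there a multiple of `q`
times. Equal sets of later letters guarantee that a leftover letter recurs in `u` at or after the
index of its gap. -/
theorem exists_merge_of_annotate {q n m : ℕ} {e : S} (hu : ∀ i ≥ n, u i = e) (hv : ∀ i ≥ m, v i = e)
    (hletters : ∀ s, (∃ i < n, u i = s) ↔ ∃ i < m, v i = s) (hf : StrictMono f)
    (hge : ∀ i, f (n + i) = m + i)
    (hann : ∀ i < n, annotate q u n i = annotate q v m (f i)) :
    ∃ h : ℕ → ℕ, (∀ j, u (h j) = v j) ∧ (∀ i, h (f i) = i) ∧ (∀ j, j ≤ f (h j)) ∧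
      ∀ i (F : Finset ℕ), (∀ j, j ∈ F ↔ h j = i) → (q : ℤ) ∣ (F.card : ℤ) - 1 := by
  classical
  have hlet : ∀ i < n, u i = v (f i) := fun i hi => congrArg (fun p => p.1) (hann i hi)
  have hcount : ∀ i < n, ∀ s, (Nat.count (fun i => u i = s) i : ZMod q) =
      Nat.count (fun i => v i = s) (f i) := fun i hi s =>
    congrFun (congrArg (fun p => p.2.1) (hann i hi)) s
  have hlater : ∀ i < n, ∀ s, (∃ l, i < l ∧ l < n ∧ u l = s) ↔ ∃ l, f i < l ∧ l < m ∧ v l = s :=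
    fun i hi s => iff_of_eq (congrFun (congrArg (fun p => p.2.2) (hann i hi)) s)
  have huv : ∀ i, v (f i) = u i := fun i => by
    rcases lt_or_ge i n with hi | hi
    · exact (hlet i hi).symm
    · obtain ⟨k, rfl⟩ := Nat.exists_eq_add_of_le hi
      rw [hu _ hi, hge, hv _ (by omega)]
  have hm : ∀ j ∉ Set.range f, j < m := fun j hj => by
    by_contra h
    refine hj ⟨n + (j - m), ?_⟩
    rw [hge]
    omega
  have hA : ∀ j ∉ Set.range f, ∃ i ≥ gap hf j, i < n ∧ u i = v j := by
    intro j hj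
    have hjm := hm j hj
    obtain ⟨h1, h2⟩ := (gap_eq_iff hf).1 ⟨hj, rfl⟩
    -- Gap `0` has no matched position on its left, so there the sets of all letters are used
    -- instead.
    rcases hg : gap hf j with _ | i
    · obtain ⟨i, hi⟩ := (hletters (v j)).2 ⟨j, hjm, rfl⟩
      exact ⟨i, Nat.zero_le _, hi⟩
    · have hij := h2 i (by omega)
      have hin : i < n := by
        by_contra hn
        have := hge (i - n)
        rw [Nat.add_sub_cancel' (not_lt.1 hn)] at this
        omega
      obtain ⟨l, hl⟩ := (hlater i hin (v j)).2 ⟨j, hij, hjm, rfl⟩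
      exact ⟨l, hl⟩
  have hA' : ∀ j ∉ Set.range f, ∃ i ≥ gap hf j, u i = v j := fun j hj => by
    obtain ⟨i, h1, -, h2⟩ := hA j hj
    exact ⟨i, h1, h2⟩
  refine ⟨merge u v hf, comp_merge hf huv hA', merge_apply hf, le_apply_merge hf hA',
    fun i F hF => dvd_card_fibre hf (fun j hj T hT => ?_) i F hF⟩
  have hT' : ∀ l, l ∈ T ↔ (l < f (gap hf j) ∧ ∀ i < gap hf j, f i < l) ∧ v l = v j := fun l => by
    rw [hT, ← gap_eq_iff, and_assoc]
  have hgn : gap hf j < n := by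
    obtain ⟨i, h1, h2, -⟩ := hA j hj
    omega
  rw [← ZMod.natCast_eq_zero_iff]
  rcases hg : gap hf j with _ | i
  · rw [hg] at hT' hgn
    have h1 := hcount 0 hgn (v j)
    have h2 : T = (Finset.range (f 0)).filter fun l => v l = v j := by
      ext l
      simp [hT']
    rw [Nat.count_zero, Nat.cast_zero, Nat.count_eq_card_filter_range, ← h2] at h1
    exact h1.symm
  · rw [hg] at hT' hgn
    have h1 := hcount (i + 1) hgn (v j)
    have h2 := hcount i (by omega) (v j)
    rw [count_gap _ (hf (Nat.lt_succ_self i)) T fun l => ?_, Nat.count_succ] at h1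
    · push_cast at h1
      rw [h2, huv i] at h1
      simpa using h1
    · rw [hT']
      constructor
      · rintro ⟨⟨h3, h4⟩, h5⟩
        exact ⟨h4 i (by omega), h3, h5⟩
      · rintro ⟨h3, h4, h5⟩
        exact ⟨⟨h4, fun i' hi' => (hf.monotone (by omega)).trans_lt h3⟩, h5⟩

/-- Higman's lemma for equality on a finite alphabet. -/
theorem wellQuasiOrdered_sublist (α : Type*) [Finite α] :
    WellQuasiOrdered (List.Sublist (α := α)) := by
  have h1 : (Set.univ : Set α).PartiallyWellOrderedOn Eq := fun a => by
    obtain ⟨m, n, h, h'⟩ := Finite.wellQuasiOrdered (α := α) Eq fun i => a i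
    exact ⟨m, n, h, h'⟩
  intro l
  obtain ⟨m, n, h, h'⟩ := h1.partiallyWellOrderedOn_sublistForall₂ Eq
    fun i => ⟨l i, fun _ _ => trivial⟩
  refine ⟨m, n, h, ?_⟩
  obtain ⟨l', h2, h3⟩ := List.sublistForall₂_iff.1 h'
  rw [List.forall₂_eq_eq_eq] at h2
  have h4 : l m = l' := h2
  exact h4 ▸ h3

/-- Among infinitely many eventually constant words over a finite alphabet there are two, the later
of which arises from the earlier by a merging map. -/
theorem exists_merge [Finite S] {D : Type*} [Finite D] (q : ℕ) [NeZero q] (e : S) (w : ℕ → ℕ → S)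
    (hw : ∀ a, ∃ n, ∀ i ≥ n, w a i = e) (d : ℕ → D) :
    ∃ a b, a < b ∧ d a = d b ∧ ∃ h f : ℕ → ℕ, StrictMono f ∧ (∀ j, w a (h j) = w b j) ∧
      (∀ i, h (f i) = i) ∧ (∀ j, j ≤ f (h j)) ∧
      ∀ i (F : Finset ℕ), (∀ j, j ∈ F ↔ h j = i) → (q : ℤ) ∣ (F.card : ℤ) - 1 := by
  choose n hn using hw
  have : IsPreorder (List (S × (S → ZMod q) × Set S)) List.Sublist :=
    { refl := List.Sublist.refl, trans := fun _ _ _ => List.Sublist.trans }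
  obtain ⟨a, b, hab, h1, h2⟩ :=
    ((wellQuasiOrdered_sublist (S × (S → ZMod q) × Set S)).prod
      (Finite.wellQuasiOrdered (α := D × Set S) Eq)) fun a =>
      ((List.range (n a)).map (annotate q (w a) (n a)), d a, {s | ∃ i < n a, w a i = s})
  refine ⟨a, b, hab, congrArg Prod.fst h2, ?_⟩
  have hletters := fun s => iff_of_eq (congrFun (congrArg Prod.snd h2) s)
  obtain ⟨F, hF⟩ := List.sublist_iff_exists_orderEmbedding_getElem?_eq.1 h1
  have hF' : ∀ i < n a, F i < n b ∧ annotate q (w a) (n a) i = annotate q (w b) (n b) (F i) := by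
    intro i hi
    have := hF i
    simp only [List.getElem?_map, List.getElem?_range hi, Option.map_some] at this
    by_cases hb : F i < n b
    · simp only [List.getElem?_range hb, Option.map_some, Option.some.injEq] at this
      exact ⟨hb, this⟩
    · simp [hb] at this
  -- The embedding of the finite words is continued by matching the constant tails.
  let f : ℕ → ℕ := fun i => if i < n a then F i else n b + (i - n a)
  have hf : StrictMono f := by
    intro i j hij
    simp only [f]
    have h3 : F i < F j := F.strictMono hij
    have h4 := hF' i
    split_ifs <;> grind
  have hfa : ∀ i < n a, f i = F i := fun i hi => if_pos hi
  obtain ⟨h, h3, h4, h5, h6⟩ := exists_merge_of_annotate (q := q) (hn a) (hn b) hletters hf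
    (fun i => by simp [f]) (fun i hi => by rw [hfa i hi]; exact (hF' i hi).2)
  exact ⟨h, f, hf, h3, h4, h5, h6⟩

end WordMerge

namespace CentralProduct

/-! ### The ordering -/

theorem sum_digits_lt {c : ℕ} {a : ℕ → ℕ} (ha : ∀ i, a i < c) (n : ℕ) :
    ∑ i ∈ Finset.range n, a i * c ^ i < c ^ n := by
  induction n with
  | zero => simp
  | succ n ih =>
    rw [Finset.sum_range_succ, pow_succ]
    have : (a n + 1) * c ^ n ≤ c * c ^ n := Nat.mul_le_mul_right _ (ha n)
    linarith

theorem sum_digits_lt_sum_digits {c : ℕ} {a b : ℕ → ℕ} (ha : ∀ i, a i < c) {i n : ℕ}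
    (hi : i < n) (h : ∀ j > i, a j = b j) (hab : a i < b i) :
    ∑ i ∈ Finset.range n, a i * c ^ i < ∑ i ∈ Finset.range n, b i * c ^ i := by
  induction n, hi using Nat.le_induction with
  | base =>
    rw [Finset.sum_range_succ, Finset.sum_range_succ]
    have h1 := sum_digits_lt ha i
    have h2 : (a i + 1) * c ^ i ≤ b i * c ^ i := Nat.mul_le_mul_right _ hab
    have h3 := Nat.zero_le (∑ j ∈ Finset.range i, b j * c ^ j)
    linarith
  | succ n hn ih =>
    rw [Finset.sum_range_succ, Finset.sum_range_succ, h n hn]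
    linarith

/-- Numbers coding finitely supported sequences over a finite pointed set together with an element
of a finite set, compatibly with the lexicographic order, the last entry being most significant. -/
theorem exists_code {S D : Type*} [Finite S] [Finite D] (e : S) :
    ∃ (p : S → ℕ) (r : D → ℕ), Function.Injective p ∧ Function.Injective r ∧
      ∀ {X : Type*} (w : X → ℕ → S) (d : X → D), (∀ x, ∃ n, ∀ i ≥ n, w x i = e) →
        ∃ code : X → ℕ, ∀ x y, (∃ i, (∀ j > i, w x j = w y j) ∧ p (w x i) < p (w y i)) ∨
          (w x = w y ∧ r (d x) < r (d y)) → code x < code y := by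
  classical
  obtain ⟨c, ⟨E⟩⟩ := Finite.exists_equiv_fin S
  obtain ⟨m, ⟨R⟩⟩ := Finite.exists_equiv_fin D
  have hc : 0 < c := (E e).pos
  -- The swap gives `e` the digit `0`, so the value in base `c` does not depend on where the word is
  -- cut off.
  let p : S → ℕ := fun s => (Equiv.swap (E e) ⟨0, hc⟩ (E s) : Fin c)
  have hpe : p e = 0 := by simp [p]
  refine ⟨p, fun x => R x, fun s t h => ?_, Fin.val_injective.comp R.injective, ?_⟩
  · exact E.injective ((Equiv.swap _ _).injective (Fin.val_injective h))
  intro X w d hw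
  choose n hn using hw
  let V : X → ℕ := fun x => ∑ i ∈ Finset.range (n x), p (w x i) * c ^ i
  have hV : ∀ x N, n x ≤ N → V x = ∑ i ∈ Finset.range N, p (w x i) * c ^ i := fun x N hN => by
    refine Finset.sum_subset (Finset.range_subset_range.2 hN) fun i _ hi => ?_
    rw [hn x i (by simpa using hi), hpe, zero_mul]
  refine ⟨fun x => m * V x + R (d x), fun x y h => ?_⟩
  have hx := (R (d x)).2
  obtain ⟨i, h1, h2⟩ | ⟨h1, h2⟩ := h
  · have h3 : V x < V y := by
      let N := max (n x) (max (n y) (i + 1))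
      rw [hV x N (by omega), hV y N (by omega)]
      exact sum_digits_lt_sum_digits (fun j => Fin.is_lt _) (by omega)
        (fun j hj => by rw [h1 j hj]) h2
    have h4 : m * (V x + 1) ≤ m * V y := Nat.mul_le_mul_left _ h3
    dsimp only
    linarith
  · have h3 : V x = V y := by
      let N := max (n x) (n y)
      rw [hV x N (by omega), hV y N (by omega), h1]
    simpa only [h3, Nat.add_lt_add_iff_left] using h2

theorem exists_max_ne {S : Type*} {e : S} {a b : ℕ → S} (ha : ∃ n, ∀ i ≥ n, a i = e)
    (hb : ∃ n, ∀ i ≥ n, b i = e) (hab : a ≠ b) : ∃ i, (∀ j > i, a j = b j) ∧ a i ≠ b i := by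
  classical
  obtain ⟨n, hn⟩ := ha
  obtain ⟨m, hm⟩ := hb
  obtain ⟨i, hi⟩ := Function.ne_iff.1 hab
  have hbd : ∀ j, a j ≠ b j → j ≤ max n m := fun j hj => by
    by_contra h
    exact hj ((hn j (by omega)).trans (hm j (by omega)).symm)
  refine ⟨Nat.findGreatest (fun j => a j ≠ b j) (max n m), fun j hj => ?_,
    Nat.findGreatest_spec (P := fun j => a j ≠ b j) (hbd i hi) hi⟩
  by_contra h
  exact absurd (Nat.le_findGreatest (P := fun j => a j ≠ b j) (hbd j h) h) (not_le.2 hj)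

variable {G : Type u} [Group G] {K : Subgroup G}

theorem normal_of_le_center (hKZ : K ≤ Subgroup.center G) : K.Normal :=
  ⟨fun k hk g => by rwa [Subgroup.mem_center_iff.1 (hKZ hk) g, mul_inv_cancel_right]⟩

/-- A numbering of `G(ω; K)` respected by suitable reindexing maps. -/
theorem exists_numbering [Finite G] (hGK : commutator G ≤ K) (hKZ : K ≤ Subgroup.center G)
    [K.Normal] :
    ∃ (κ : CentralProduct ℕ K → K) (code : CentralProduct ℕ K → ℕ),
      Function.Injective code ∧ (∀ x y, shape x = shape y → κ x = κ y → x = y) ∧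
      ∀ (h f : ℕ → ℕ) (hh : IsMerge G h), StrictMono f → (∀ i, h (f i) = i) → (∀ j, j ≤ f (h j)) →
        (∀ x, shape (hh.hom hGK hKZ x) = shape x ∘ h ∧ κ (hh.hom hGK hKZ x) = κ x) ∧
        ∀ x y, code x < code y → code (hh.hom hGK hKZ x) < code (hh.hom hGK hKZ y) := by
  obtain ⟨κ, hκ, hred⟩ := exists_coordinates hGK hKZ
  obtain ⟨p, r, hp, hr, hpr⟩ := exists_code (D := K) (1 : G ⧸ K)
  obtain ⟨code, hcode⟩ := hpr (fun x => shape (K := K) x) κ exists_bound_shape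
  -- Lexicographic precedence is total on distinct elements; hence `code` is injective and also
  -- reflects it.
  have htri : ∀ x y : CentralProduct ℕ K, x ≠ y →
      ((∃ i, (∀ j > i, shape x j = shape y j) ∧ p (shape x i) < p (shape y i)) ∨
          (shape x = shape y ∧ r (κ x) < r (κ y))) ∨
      ((∃ i, (∀ j > i, shape y j = shape x j) ∧ p (shape y i) < p (shape x i)) ∨
          (shape y = shape x ∧ r (κ y) < r (κ x))) := by
    intro x y hxy
    by_cases hs : shape x = shape y
    · have hne : r (κ x) ≠ r (κ y) := fun h => hxy (hκ x y hs (hr h))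
      rcases hne.lt_or_gt with h | h
      · exact Or.inl (Or.inr ⟨hs, h⟩)
      · exact Or.inr (Or.inr ⟨hs.symm, h⟩)
    · obtain ⟨i, h1, h2⟩ := exists_max_ne (exists_bound_shape x) (exists_bound_shape y) hs
      have hne : p (shape x i) ≠ p (shape y i) := fun h => h2 (hp h)
      rcases hne.lt_or_gt with h | h
      · exact Or.inl (Or.inl ⟨i, h1, h⟩)
      · exact Or.inr (Or.inl ⟨i, fun j hj => (h1 j hj).symm, h⟩)
  refine ⟨κ, code, fun x y h => ?_, hκ, fun h f hh hf hhf hle => ⟨hred h hh, fun x y hxy => ?_⟩⟩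
  · by_contra hne
    rcases htri x y hne with h' | h'
    · exact (hcode x y h').ne h
    · exact (hcode y x h').ne h.symm
  · have hne : x ≠ y := fun e => hxy.ne (congrArg code e)
    refine hcode _ _ ?_
    rcases htri x y hne with h' | h'
    · obtain ⟨hx, hx'⟩ := hred h hh x
      obtain ⟨hy, hy'⟩ := hred h hh y
      rw [hx, hy, hx', hy']
      obtain ⟨i, h1, h2⟩ | ⟨h1, h2⟩ := h'
      -- As `f i` is the largest point of the fibre over `i`, positions beyond it are sent beyond
      -- `i`; the last difference moves from `i` to `f i`.
      · refine Or.inl ⟨f i, fun j hj => h1 _ (hf.lt_iff_lt.1 (lt_of_lt_of_le hj (hle j))), ?_⟩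
        simpa [hhf] using h2
      · exact Or.inr ⟨by rw [h1], h2⟩
    · exact absurd (hcode y x h') (not_lt.2 hxy.le)

/-! ### The main results -/

/-- The defining property of an AZ-enumeration, with constants for the elements of `K`. -/
theorem exists_enumeration [Finite G] (hGK : commutator G ≤ K) (hKZ : K ≤ Subgroup.center G)
    [Infinite (CentralProduct ℕ K)] :
    ∃ e : ℕ ≃ CentralProduct ℕ K, IsAZEnumeration groupLanguage[[K]] e := by
  have : K.Normal := normal_of_le_center hKZ
  obtain ⟨κ, code, hinj, hκ, hcode⟩ := exists_numbering hGK hKZ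
  classical
  have : Infinite (Set.range code) := Set.infinite_coe_iff.2 (Set.infinite_range_of_injective hinj)
  let o : ℕ ≃o Set.range code := Nat.Subtype.orderIsoOfNat (Set.range code)
  let c := Equiv.ofInjective code hinj
  let e : ℕ ≃ CentralProduct ℕ K := o.toEquiv.trans c.symm
  have he : ∀ x y, e.symm x < e.symm y ↔ code x < code y := fun x y =>
    o.symm.lt_iff_lt (x := c x) (y := c y)
  refine ⟨e, fun n a => ?_⟩
  obtain ⟨i, j, hij, hd, h, f, hf, hw, hhf, hle, hcard⟩ :=
    -- A tuple is read as one word over `(G ⧸ K)^n`, so a single merging map serves all its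
    -- components; the `K`-coordinates form the finite label.
    WordMerge.exists_merge (2 * Nat.card G) (1 : Fin n → G ⧸ K)
    (fun m j t => shape (a m t) j) (fun m => by
      choose b hb using fun t => exists_bound_shape (a m t)
      obtain ⟨B, hB⟩ := (Set.finite_range b).bddAbove
      exact ⟨B, fun i hi => funext fun t => hb t i ((hB ⟨t, rfl⟩).trans hi)⟩)
    (fun m t => κ (a m t))
  have hfin : ∀ i, (h ⁻¹' {i}).Finite := fun i =>
    (Set.finite_le_nat (f i)).subset fun j hj => by
      have := hle j
      rw [show h j = i from hj] at this
      exact this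
  have hh : IsMerge G h := ⟨hfin, fun i => by
    simpa using hcard i (hfin i).toFinset fun j => by simp⟩
  obtain ⟨h1, h2⟩ := hcode h f hh hf hhf hle
  refine ⟨i, j, hij, hh.elementaryEmbedding hGK hKZ, fun x y hxy => ?_, fun t => ?_⟩
  · rw [he] at hxy ⊢
    exact h2 x y hxy
  · refine hκ _ _ ((h1 _).1.trans ?_) ((h1 _).2.trans (congrFun hd t))
    exact funext fun l => congrFun (hw l) t

end CentralProduct

/-! ### Consequences of an AZ-enumeration -/

namespace FirstOrder.Language

variable {L : Language.{u, v}} {M : Type w} [L.Structure M]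

/-- In a sequence of tuples of pairwise distinct types no member could be carried to another by an
elementary map. -/
theorem finite_types_of_isAZEnumeration {e : ℕ ≃ M} (he : IsAZEnumeration L e) (n : ℕ) :
    Finite (Quotient (typeSetoid L M (Fin n))) := by
  by_contra hinf
  rw [not_finite_iff_infinite] at hinf
  let q := Infinite.natEmbedding (Quotient (typeSetoid L M (Fin n)))
  obtain ⟨i, j, hij, α, -, hα⟩ := he n fun i => (q i).out
  refine hij.ne (q.injective ?_)
  rw [← Quotient.out_eq (q i), ← Quotient.out_eq (q j)]
  refine Quotient.sound (show TypeAgree L _ _ from ?_)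
  have : (q j).out = α ∘ (q i).out := funext fun t => (hα t).symm
  rw [this]
  exact fun φ => (α.map_formula φ _).symm

theorem isAZEnumeration_reduct {A : Type*} [(constantsOn A).Structure M] {e : ℕ ≃ M}
    (he : IsAZEnumeration L[[A]] e) : IsAZEnumeration L e := by
  intro n a
  obtain ⟨i, j, hij, α, h1, h2⟩ := he n a
  refine ⟨i, j, hij, ⟨α, fun n φ x => ?_⟩, h1, h2⟩
  have := α.map_formula ((L.lhomWithConstants A).onFormula φ) x
  rwa [LHom.realize_onFormula, LHom.realize_onFormula] at this

end FirstOrder.Language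

/-! ### Infinitude and the main theorem -/

namespace CentralProduct

variable {G : Type u} [Group G] {K : Subgroup G}

/-- The copies of an element outside `K` are told apart by their sequences of cosets. -/
theorem infinite_of_ne_top [K.Normal] (hK : K ≠ ⊤) : Infinite (CentralProduct ℕ K) := by
  obtain ⟨g, hg⟩ : ∃ g, g ∉ K := by
    by_contra! h
    exact hK (eq_top_iff.2 fun g _ => h g)
  refine Infinite.of_injective (fun i : ℕ => copy K i g) fun i j hij => ?_
  by_contra hne
  have := congrFun (congrArg shape hij) i
  simp only [copy_apply, shape_mk, singleEntry_same, singleEntry_of_ne hne] at this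
  exact hg ((QuotientGroup.eq_one_iff g).1 this)

/-- If `K` were all of `G`, then `G` would be abelian, of class at most one. -/
theorem ne_top_of_nilpotencyClass [Group.IsNilpotent G] (hG : Group.nilpotencyClass G = 2)
    (hKZ : K ≤ Subgroup.center G) : K ≠ ⊤ := by
  rintro rfl
  have : Group.nilpotencyClass G ≤ 1 := by
    rw [← Subgroup.upperCentralSeries_eq_top_iff_nilpotencyClass_le, Subgroup.upperCentralSeries_one]
    exact top_le_iff.1 hKZ
  omega

end CentralProduct

open CentralProduct in
theorem mainTheorem3 (G : Type u) [Group G] [Finite G] [Group.IsNilpotent G]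
    (hG : Group.nilpotencyClass G = 2) (K : Subgroup G)
    (hGK : commutator G ≤ K) (hKZ : K ≤ Subgroup.center G) :
    SmoothlyApproximable (groupLanguage[[K]]) (CentralProduct ℕ K) ∧
    (∀ (n : ℕ) [NeZero n],
      ∃ j : CentralProduct (Fin n) K ↪[groupLanguage[[K]]] CentralProduct ℕ K,
        (∀ x, j x = levelMap K n x) ∧ IsFiniteApproximation j.toHom.range) ∧
    (∀ F : Set (CentralProduct ℕ K), F.Finite →
      ∃ n : ℕ, 0 < n ∧ F ⊆ Set.range (levelMap K n)) ∧
    ∃ e : ℕ ≃ CentralProduct ℕ K, IsAZEnumeration groupLanguage e := by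
  have : K.Normal := normal_of_le_center hKZ
  have : Infinite (CentralProduct ℕ K) := infinite_of_ne_top (ne_top_of_nilpotencyClass hG hKZ)
  obtain ⟨e, he⟩ := exists_enumeration hGK hKZ
  have : Countable (CentralProduct ℕ K) := e.symm.injective.countable
  refine ⟨⟨Language.omegaCategorical_of_finite_types _
      (Language.finite_types_of_isAZEnumeration he), fun F hF => ?_⟩,
    fun n _ => ⟨levelEmbedding hKZ n, fun _ => rfl, isFiniteApproximation_level hKZ⟩,
    fun F hF => exists_level_of_finite hF, e, Language.isAZEnumeration_reduct he⟩
  obtain ⟨n, hn, hF'⟩ := exists_level_of_finite hF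
  have : NeZero n := ⟨hn.ne'⟩
  exact ⟨_, hF', isFiniteApproximation_level (n := n) hKZ⟩
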